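/- Let $\mathfrak C=\mathbb C\oplus\mathbb C^3$ be the division octonions, with $$(a+m)(b+n)=(ab-{}^tm\,\bar n)+(an+\bar b\,m+\overline{m\times n}),\qquad \overline{a+m}=\bar a-m ,$$ where $m\times n$ is the vector product of $\mathbb C^3$. Let $\mathfrak J$ be the exceptional Jordan algebra of Hermitian $3\times3$ matrices $$X=\begin{pmatrix}\xi_1&x_3&\bar x_2\\ \bar x_3&\xi_2&x_1\\ x_2&\bar x_1&\xi_3\end{pmatrix},\qquad \xi_i\in\mathbb R,\ x_i\in\mathfrak C ,$$ with $X\circ Y=\tfrac12(XY+YX)$, $(X,Y)=\operatorname{tr}(X\circ Y)$ and the Freudenthal product $$X\times Y=\tfrac12\bigl(2X\circ Y-\operatorname{tr}(X)Y-\operatorname{tr}(Y)X+(\operatorname{tr}(X)\operatorname{tr}(Y)-(X,Y))E\bigr).$$ Let $F_4=\{\alpha\in\mathrm{Iso}_{\mathbb R}(\mathfrak J)\mid \alpha(X\times Y)=\alpha X\times\alpha Y\}$, with its topology as a group of linear operators, and let $G_2=\mathrm{Aut}(\mathfrak C)\subset F_4$ act on the entries of $X$. Let $\gamma,\gamma',\gamma_1$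 be the maps of $\mathfrak J$ which fix the $\xi_i$ and apply to each $x_i$ the maps $$a+(n_1,n_2,n_3)\mapsto a+(n_1,-n_2,-n_3),\quad a+(n_1,n_2,n_3)\mapsto a+(-n_1,n_2,-n_3),\quad a+n\mapsto\bar a+\bar n$$ respectively, and let $\sigma,\sigma'$ be the maps which fix the $\xi_i$ and send $(x_1,x_2,x_3)$ to $(x_1,-x_2,-x_3)$ and $(-x_1,-x_2,x_3)$ respectively. **Theorem 2.3.** The maps $\gamma,\gamma',\gamma_1$ lie in $G_2\subset F_4$ and $\sigma,\sigma'$ lie in $F_4$; these five elements have order two and commute with one another. Let $$K=(F_4)^{\gamma,\gamma',\sigma,\sigma'}=\{\alpha\in F_4\mid \tau\alpha=\alpha\tau\ \text{for}\ \tau=\gamma,\gamma',\sigma,\sigma'\}.$$ Then, as topological groups: 1. the identity component $K_0$ is isomorphic to the torus $U(1)^{\times4}$, and $K_0$ is a maximal torus of $F_4$; 2. $\gamma_1\in K$, and $K$ is isomorphic to the semidirect product $U(1)^{\times4}\cdot\mathbb Z_2$, where the generator of $\mathbb Z_2$ acts on $U(1)^{\times4}$ by complex conjugation of all four coordinates,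 by an isomorphism that sends $\gamma_1$ to the generator of $\mathbb Z_2$. -/

import Mathlib

noncomputable section

open scoped Matrix

namespace ExcF4

/-! ## The division octonions -/

/-- The Cayley algebra in the form `ℂ ⊕ ℂ³`; an element is written `a + m`. -/
def Octo : Type := ℂ × (Fin 3 → ℂ)

instance : NormedAddCommGroup Octo := inferInstanceAs (NormedAddCommGroup (ℂ × (Fin 3 → ℂ)))
instance : NormedSpace ℝ Octo := inferInstanceAs (NormedSpace ℝ (ℂ × (Fin 3 → ℂ)))
instance : FiniteDimensional ℝ Octo :=
  inferInstanceAs (FiniteDimensional ℝ (ℂ × (Fin 3 → ℂ)))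

namespace Octo

/-- The octonion `a + m`. -/
def mk (a : ℂ) (m : Fin 3 → ℂ) : Octo := (a, m)

/-- The component in `ℂ`. -/
def scal (x : Octo) : ℂ := x.1

/-- The component in `ℂ³`. -/
def vect (x : Octo) : Fin 3 → ℂ := x.2

/-- `(a + m)(b + n) = (a b - ᵗm n̄) + (a n + b̄ m + conj (m × n))`, with the vector product
`m × n` of `ℂ³`. -/
instance : Mul Octo :=
  ⟨fun x y => mk (x.scal * y.scal - x.vect ⬝ᵥ star y.vect)
    (x.scal • y.vect + star y.scal • x.vect + star (crossProduct x.vect y.vect))⟩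

/-- Octonionic conjugation, `a + m ↦ ā - m`. -/
instance : Star Octo := ⟨fun x => mk (star x.scal) (-x.vect)⟩

/-- The real number `r` as an octonion. -/
def ofReal (r : ℝ) : Octo := mk (r : ℂ) 0

/-- The real part. -/
def re (x : Octo) : ℝ := x.scal.re

@[ext] theorem ext {x y : Octo} (h : x.scal = y.scal) (h' : ∀ i, x.vect i = y.vect i) : x = y :=
  Prod.ext h (funext h')

@[simp] theorem scal_mk (a : ℂ) (m : Fin 3 → ℂ) : (mk a m).scal = a := rfl
@[simp] theorem vect_mk (a : ℂ) (m : Fin 3 → ℂ) : (mk a m).vect = m := rfl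
@[simp] theorem scal_add (x y : Octo) : (x + y).scal = x.scal + y.scal := rfl
@[simp] theorem vect_add (x y : Octo) : (x + y).vect = x.vect + y.vect := rfl
@[simp] theorem scal_sub (x y : Octo) : (x - y).scal = x.scal - y.scal := rfl
@[simp] theorem vect_sub (x y : Octo) : (x - y).vect = x.vect - y.vect := rfl
@[simp] theorem scal_neg (x : Octo) : (-x).scal = -x.scal := rfl
@[simp] theorem vect_neg (x : Octo) : (-x).vect = -x.vect := rfl
@[simp] theorem scal_zero : (0 : Octo).scal = 0 := rfl
@[simp] theorem vect_zero : (0 : Octo).vect = 0 := rfl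
@[simp] theorem scal_smul (r : ℝ) (x : Octo) : (r • x).scal = r * x.scal := Complex.real_smul
@[simp] theorem vect_smul (r : ℝ) (x : Octo) : (r • x).vect = r • x.vect := rfl
@[simp] theorem scal_star (x : Octo) : (star x).scal = star x.scal := rfl
@[simp] theorem vect_star (x : Octo) : (star x).vect = -x.vect := rfl
@[simp] theorem scal_mul (x y : Octo) :
    (x * y).scal = x.scal * y.scal - x.vect ⬝ᵥ star y.vect := rfl
@[simp] theorem vect_mul (x y : Octo) : (x * y).vect =
    x.scal • y.vect + star y.scal • x.vect + star (crossProduct x.vect y.vect) := rfl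
theorem star_add (x y : Octo) : star (x + y) = star x + star y := by
  ext i
  · simp
  · simp
    ring

theorem star_smul (r : ℝ) (x : Octo) : star (r • x) = r • star x := by
  ext i <;> simp

theorem star_mul (x y : Octo) : star (x * y) = star y * star x := by
  ext i
  · simp [dotProduct, Fin.sum_univ_three]
    ring
  · fin_cases i <;> simp [crossProduct] <;> ring

@[simp] theorem scal_ofReal (r : ℝ) : (ofReal r).scal = r := rfl
@[simp] theorem vect_ofReal (r : ℝ) : (ofReal r).vect = 0 := rfl

end Octo

/-- The compact group `G₂` of algebra automorphisms of the octonions. -/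
def G2 : Subgroup (Octo →L[ℝ] Octo)ˣ where
  carrier := {g | ∀ x y : Octo, g.1 (x * y) = g.1 x * g.1 y}
  one_mem' := fun _ _ => rfl
  mul_mem' := by
    intro a b ha hb x y
    change a.1 (b.1 (x * y)) = a.1 (b.1 x) * a.1 (b.1 y)
    rw [hb, ha]
  inv_mem' := by
    intro a ha x y
    have h1 : ∀ z, a⁻¹.1 (a.1 z) = z := fun z => congrArg (fun f => f z) a.inv_mul
    have h2 : ∀ z, a.1 (a⁻¹.1 z) = z := fun z => congrArg (fun f => f z) a.mul_inv
    have := ha (a⁻¹.1 x) (a⁻¹.1 y)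
    rw [h2, h2] at this
    rw [← this, h1]

/-! ## The exceptional Jordan algebra -/

/-- The exceptional Jordan algebra, in coordinates: the element `X(ξ, x)` has three real
diagonal entries `ξ` and three octonions `x`; see `Jord.toMatrix`. -/
def Jord : Type := (Fin 3 → ℝ) × (Fin 3 → Octo)

instance : NormedAddCommGroup Jord :=
  inferInstanceAs (NormedAddCommGroup ((Fin 3 → ℝ) × (Fin 3 → Octo)))
instance : NormedSpace ℝ Jord := inferInstanceAs (NormedSpace ℝ ((Fin 3 → ℝ) × (Fin 3 → Octo)))
instance : FiniteDimensional ℝ Jord :=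
  inferInstanceAs (FiniteDimensional ℝ ((Fin 3 → ℝ) × (Fin 3 → Octo)))

namespace Jord

/-- The element with diagonal entries `ξ` and off-diagonal octonions `x`. -/
def mk (ξ : Fin 3 → ℝ) (x : Fin 3 → Octo) : Jord := (ξ, x)

/-- The diagonal entries. -/
def diag (X : Jord) : Fin 3 → ℝ := X.1

/-- The octonions `x₁, x₂, x₃`. -/
def off (X : Jord) : Fin 3 → Octo := X.2

@[ext] theorem ext {X Y : Jord} (h : ∀ i, X.diag i = Y.diag i) (h' : ∀ i, X.off i = Y.off i) :
    X = Y :=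
  Prod.ext (funext h) (funext h')

@[simp] theorem diag_mk (ξ : Fin 3 → ℝ) (x : Fin 3 → Octo) : (mk ξ x).diag = ξ := rfl
@[simp] theorem off_mk (ξ : Fin 3 → ℝ) (x : Fin 3 → Octo) : (mk ξ x).off = x := rfl
@[simp] theorem diag_add (X Y : Jord) : (X + Y).diag = X.diag + Y.diag := rfl
@[simp] theorem off_add (X Y : Jord) : (X + Y).off = X.off + Y.off := rfl
@[simp] theorem diag_sub (X Y : Jord) : (X - Y).diag = X.diag - Y.diag := rfl
@[simp] theorem off_sub (X Y : Jord) : (X - Y).off = X.off - Y.off := rfl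
@[simp] theorem diag_smul (r : ℝ) (X : Jord) : (r • X).diag = r • X.diag := rfl
@[simp] theorem off_smul (r : ℝ) (X : Jord) : (r • X).off = r • X.off := rfl

/-- The octonionic matrix `X(ξ, x)`. -/
def toMatrix (X : Jord) : Matrix (Fin 3) (Fin 3) Octo :=
  !![Octo.ofReal (X.diag 0), X.off 2, star (X.off 1);
     star (X.off 2), Octo.ofReal (X.diag 1), X.off 0;
     X.off 1, star (X.off 0), Octo.ofReal (X.diag 2)]

/-- The coordinates of a Hermitian octonionic matrix. -/
def ofMatrix (A : Matrix (Fin 3) (Fin 3) Octo) : Jord :=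
  mk (fun i => (A i i).re) ![A 1 2, A 2 0, A 0 1]

theorem ofMatrix_toMatrix (X : Jord) : ofMatrix X.toMatrix = X := by
  ext i
  · fin_cases i <;> simp [ofMatrix, toMatrix, Octo.re]
  · fin_cases i <;> simp [ofMatrix, toMatrix]
  · fin_cases i <;> simp [ofMatrix, toMatrix]

theorem conjTranspose_toMatrix (X : Jord) : X.toMatrixᴴ = X.toMatrix := by
  ext i j <;> fin_cases i <;> fin_cases j <;> simp [toMatrix]

theorem toMatrix_ofMatrix (A : Matrix (Fin 3) (Fin 3) Octo) (hA : Aᴴ = A) :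
    (ofMatrix A).toMatrix = A := by
  have h : ∀ i j, star (A i j) = A j i := fun i j => congrFun (congrFun hA j) i
  have hd : ∀ i, Octo.ofReal (A i i).re = A i i := by
    intro i
    have h1 := congrArg Octo.scal (h i i)
    have h2 := fun k => congrFun (congrArg Octo.vect (h i i)) k
    ext k
    · exact Complex.conj_eq_iff_re.1 h1
    · have := h2 k
      simp only [Octo.vect_star, Pi.neg_apply] at this
      simp only [Octo.vect_ofReal, Pi.zero_apply]
      linear_combination (1 / 2 : ℂ) * this
  refine Matrix.ext fun i j => ?_
  fin_cases i <;> fin_cases j <;> simp [toMatrix, ofMatrix, h, hd]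

/-- The Jordan product `X ∘ Y = (XY + YX) / 2`, through the product of octonionic matrices. -/
def jordan (X Y : Jord) : Jord :=
  ofMatrix ((1 / 2 : ℝ) • (X.toMatrix * Y.toMatrix + Y.toMatrix * X.toMatrix))

theorem toMatrix_jordan (X Y : Jord) : (jordan X Y).toMatrix =
    (1 / 2 : ℝ) • (X.toMatrix * Y.toMatrix + Y.toMatrix * X.toMatrix) := by
  apply toMatrix_ofMatrix
  have hX := fun i j => congrFun (congrFun (conjTranspose_toMatrix X) i) j
  have hY := fun i j => congrFun (congrFun (conjTranspose_toMatrix Y) i) j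
  simp only [Matrix.conjTranspose_apply] at hX hY
  refine Matrix.ext fun i j => ?_
  simp only [Matrix.conjTranspose_apply, Matrix.smul_apply, Matrix.add_apply, Matrix.mul_apply,
    Fin.sum_univ_three, Octo.star_add, Octo.star_smul, Octo.star_mul, hX, hY]
  abel_nf

/-- The trace. -/
def tr (X : Jord) : ℝ := ∑ i, X.diag i

/-- The inner product `(X, Y) = tr (X ∘ Y)`. -/
def inn (X Y : Jord) : ℝ := tr (jordan X Y)

/-- The unit matrix `E`. -/
def unit : Jord := mk 1 0

/-- The Freudenthal product
`X × Y = (2 X ∘ Y - tr(X) Y - tr(Y) X + (tr(X) tr(Y) - (X, Y)) E) / 2`. -/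
def freudenthal (X Y : Jord) : Jord :=
  (1 / 2 : ℝ) • ((2 : ℝ) • jordan X Y - tr X • Y - tr Y • X + (tr X * tr Y - inn X Y) • unit)

end Jord

/-- The compact group `F₄ = {α ∈ Iso_ℝ(𝔍) | α(X × Y) = αX × αY}`, with the topology of
the group of invertible linear operators. -/
def F4 : Subgroup (Jord →L[ℝ] Jord)ˣ where
  carrier := {α | ∀ X Y : Jord,
    α.1 (Jord.freudenthal X Y) = Jord.freudenthal (α.1 X) (α.1 Y)}
  one_mem' := fun _ _ => rfl
  mul_mem' := by
    intro a b ha hb X Y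
    change a.1 (b.1 _) = Jord.freudenthal (a.1 (b.1 X)) (a.1 (b.1 Y))
    rw [hb, ha]
  inv_mem' := by
    intro a ha X Y
    have h1 : ∀ Z, a⁻¹.1 (a.1 Z) = Z := fun Z => congrArg (fun f => f Z) a.inv_mul
    have h2 : ∀ Z, a.1 (a⁻¹.1 Z) = Z := fun Z => congrArg (fun f => f Z) a.mul_inv
    have := ha (a⁻¹.1 X) (a⁻¹.1 Y)
    rw [h2, h2] at this
    rw [← this, h1]

/-! ## The involutions -/

/-- The `ℝ`-linear map `a + m ↦ a + γ m` of the octonions, `γ(n₁, n₂, n₃) = (n₁, -n₂, -n₃)`. -/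
def gammaOcto : Octo →L[ℝ] Octo :=
  LinearMap.toContinuousLinearMap
    { toFun := fun x => Octo.mk x.scal ![x.vect 0, -x.vect 1, -x.vect 2]
      map_add' := by
        intro x y
        ext i
        · simp
        · fin_cases i <;> simp <;> ring
      map_smul' := by
        intro r x
        ext i
        · simp
        · fin_cases i <;> simp }

/-- The map `a + m ↦ a + γ' m`, `γ'(n₁, n₂, n₃) = (-n₁, n₂, -n₃)`. -/
def gammaOcto' : Octo →L[ℝ] Octo :=
  LinearMap.toContinuousLinearMap
    { toFun := fun x => Octo.mk x.scal ![-x.vect 0, x.vect 1, -x.vect 2]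
      map_add' := by
        intro x y
        ext i
        · simp
        · fin_cases i <;> simp <;> ring
      map_smul' := by
        intro r x
        ext i
        · simp
        · fin_cases i <;> simp }

/-- The complex conjugation `a + m ↦ ā + m̄`. -/
def gammaOcto₁ : Octo →L[ℝ] Octo :=
  LinearMap.toContinuousLinearMap
    { toFun := fun x => Octo.mk (star x.scal) (star x.vect)
      map_add' := by
        intro x y
        ext i <;> simp
      map_smul' := by
        intro r x
        ext i <;> simp }

/-- A linear map of the octonions, applied to every entry of an element of `𝔍` (on the
diagonal it acts as the identity). -/
def entrywise (g : Octo →L[ℝ] Octo) : Jord →L[ℝ] Jord :=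
  LinearMap.toContinuousLinearMap
    { toFun := fun X => Jord.mk X.diag fun i => g (X.off i)
      map_add' := by
        intro X Y
        apply Jord.ext <;> simp
      map_smul' := by
        intro r X
        apply Jord.ext <;> simp }

/-- `σ` fixes the diagonal and maps `(x₁, x₂, x₃)` to `(x₁, -x₂, -x₃)`. -/
def sigmaMap : Jord →L[ℝ] Jord :=
  LinearMap.toContinuousLinearMap
    { toFun := fun X => Jord.mk X.diag ![X.off 0, -X.off 1, -X.off 2]
      map_add' := by
        intro X Y
        apply Jord.ext <;> intro i
        · simp
        · fin_cases i <;> simp <;> abel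
      map_smul' := by
        intro r X
        apply Jord.ext <;> intro i
        · simp
        · fin_cases i <;> simp }

/-- `σ'` fixes the diagonal and maps `(x₁, x₂, x₃)` to `(-x₁, -x₂, x₃)`. -/
def sigmaMap' : Jord →L[ℝ] Jord :=
  LinearMap.toContinuousLinearMap
    { toFun := fun X => Jord.mk X.diag ![-X.off 0, -X.off 1, X.off 2]
      map_add' := by
        intro X Y
        apply Jord.ext <;> intro i
        · simp
        · fin_cases i <;> simp <;> abel
      map_smul' := by
        intro r X
        apply Jord.ext <;> intro i
        · simp
        · fin_cases i <;> simp }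

theorem freudenthal_of_jordan (f : Jord →L[ℝ] Jord) (ht : ∀ X, (f X).tr = X.tr)
    (hu : f Jord.unit = Jord.unit)
    (hj : ∀ X Y, f (Jord.jordan X Y) = Jord.jordan (f X) (f Y)) (X Y : Jord) :
    f (Jord.freudenthal X Y) = Jord.freudenthal (f X) (f Y) := by
  simp only [Jord.freudenthal, Jord.inn, map_smul, map_add, map_sub, ← hj, ht, hu]

theorem freudenthal_entrywise (g : Octo →L[ℝ] Octo) (hm : ∀ x y, g (x * y) = g x * g y)
    (hs : ∀ x, g (star x) = star (g x)) (hr : ∀ r, g (Octo.ofReal r) = Octo.ofReal r)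
    (hre : ∀ x, (g x).re = x.re) (X Y : Jord) :
    entrywise g (Jord.freudenthal X Y) = Jord.freudenthal (entrywise g X) (entrywise g Y) := by
  refine freudenthal_of_jordan _ (fun X => rfl) ?_ (fun X Y => ?_) X Y
  · exact Jord.ext (fun i => rfl) fun i => map_zero g
  · have h1 : ∀ X i j, (entrywise g X).toMatrix i j = g (X.toMatrix i j) := by
      intro X i j
      fin_cases i <;> fin_cases j <;> simp [Jord.toMatrix, hs, hr] <;> rfl
    have h2 : ∀ A B : Matrix (Fin 3) (Fin 3) Octo, (∀ i j, B i j = g (A i j)) →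
        entrywise g (Jord.ofMatrix A) = Jord.ofMatrix B := by
      intro A B h
      refine Jord.ext (fun i => ?_) fun i => ?_
      · simp only [Jord.ofMatrix, Jord.diag_mk, h, hre]
        rfl
      · fin_cases i <;> simp [Jord.ofMatrix, h] <;> rfl
    refine h2 _ _ fun i j => ?_
    simp only [Matrix.smul_apply, Matrix.add_apply, Matrix.mul_apply, Fin.sum_univ_three, h1,
      map_smul, map_add, hm]

theorem gammaOcto_mul (x y : Octo) : gammaOcto (x * y) = gammaOcto x * gammaOcto y := by
  ext i
  · simp [gammaOcto, dotProduct, Fin.sum_univ_three]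
  · fin_cases i <;> simp [gammaOcto, crossProduct] <;> ring

theorem gammaOcto'_mul (x y : Octo) : gammaOcto' (x * y) = gammaOcto' x * gammaOcto' y := by
  ext i
  · simp [gammaOcto', dotProduct, Fin.sum_univ_three]
  · fin_cases i <;> simp [gammaOcto', crossProduct] <;> ring

theorem gammaOcto₁_mul (x y : Octo) : gammaOcto₁ (x * y) = gammaOcto₁ x * gammaOcto₁ y := by
  ext i
  · simp [gammaOcto₁, dotProduct, Fin.sum_univ_three]
  · simp only [Octo.vect_mul, gammaOcto₁, LinearMap.coe_toContinuousLinearMap', LinearMap.coe_mk,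
      AddHom.coe_mk, Octo.vect_mk, Octo.scal_mk, Pi.add_apply, Pi.smul_apply, Pi.star_apply]
    fin_cases i <;> simp [crossProduct]

theorem gammaOcto_sq : gammaOcto * gammaOcto = 1 := by
  refine ContinuousLinearMap.ext fun x => Octo.ext rfl fun i => ?_
  fin_cases i <;> simp [gammaOcto]

theorem gammaOcto'_sq : gammaOcto' * gammaOcto' = 1 := by
  refine ContinuousLinearMap.ext fun x => Octo.ext rfl fun i => ?_
  fin_cases i <;> simp [gammaOcto']

theorem gammaOcto₁_sq : gammaOcto₁ * gammaOcto₁ = 1 := by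
  refine ContinuousLinearMap.ext fun x => Octo.ext ?_ fun i => ?_ <;> simp [gammaOcto₁]

theorem entrywise_sq (g : Octo →L[ℝ] Octo) (hg : g * g = 1) :
    entrywise g * entrywise g = 1 :=
  ContinuousLinearMap.ext fun X => Jord.ext (fun _ => rfl)
    fun i => congrArg (fun f => f (X.off i)) hg

theorem sigmaMap_sq : sigmaMap * sigmaMap = 1 := by
  refine ContinuousLinearMap.ext fun X => Jord.ext (fun _ => rfl) fun i => ?_
  fin_cases i <;> simp [sigmaMap]

theorem sigmaMap'_sq : sigmaMap' * sigmaMap' = 1 := by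
  refine ContinuousLinearMap.ext fun X => Jord.ext (fun _ => rfl) fun i => ?_
  fin_cases i <;> simp [sigmaMap']

theorem freudenthal_sigmaMap (X Y : Jord) :
    sigmaMap (Jord.freudenthal X Y) = Jord.freudenthal (sigmaMap X) (sigmaMap Y) := by
  refine freudenthal_of_jordan _ (fun X => rfl) ?_ (fun X Y => ?_) X Y
  · refine Jord.ext (fun i => rfl) fun i => ?_
    fin_cases i <;> simp [sigmaMap, Jord.unit]
  · have hc : ∀ i j k, crossProduct (Y.off i).vect (X.off j).vect k =
        -crossProduct (X.off j).vect (Y.off i).vect k := fun i j k =>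
      (congrFun (cross_anticomm _ _) k).symm
    refine Jord.ext (fun i => ?_) fun i => ?_
    · fin_cases i <;> simp [sigmaMap, Jord.jordan, Jord.ofMatrix, Jord.toMatrix, Matrix.mul_apply,
        Fin.sum_univ_three, Octo.re]
    · fin_cases i <;> ext k <;> simp [sigmaMap, Jord.jordan, Jord.ofMatrix, Jord.toMatrix,
        Matrix.mul_apply, Fin.sum_univ_three, hc] <;> ring

theorem freudenthal_sigmaMap' (X Y : Jord) :
    sigmaMap' (Jord.freudenthal X Y) = Jord.freudenthal (sigmaMap' X) (sigmaMap' Y) := by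
  refine freudenthal_of_jordan _ (fun X => rfl) ?_ (fun X Y => ?_) X Y
  · refine Jord.ext (fun i => rfl) fun i => ?_
    fin_cases i <;> simp [sigmaMap', Jord.unit]
  · have hc : ∀ i j k, crossProduct (Y.off i).vect (X.off j).vect k =
        -crossProduct (X.off j).vect (Y.off i).vect k := fun i j k =>
      (congrFun (cross_anticomm _ _) k).symm
    refine Jord.ext (fun i => ?_) fun i => ?_
    · fin_cases i <;> simp [sigmaMap', Jord.jordan, Jord.ofMatrix, Jord.toMatrix, Matrix.mul_apply,
        Fin.sum_univ_three, Octo.re]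
    · fin_cases i <;> ext k <;> simp [sigmaMap', Jord.jordan, Jord.ofMatrix, Jord.toMatrix,
        Matrix.mul_apply, Fin.sum_univ_three, hc] <;> ring

/-- `γ` as an element of `F₄`. -/
def γ : F4 :=
  ⟨⟨entrywise gammaOcto, entrywise gammaOcto, entrywise_sq _ gammaOcto_sq,
      entrywise_sq _ gammaOcto_sq⟩,
    freudenthal_entrywise gammaOcto gammaOcto_mul
      (fun x => Octo.ext rfl fun i => by fin_cases i <;> simp [gammaOcto])
      (fun r => Octo.ext rfl fun i => by fin_cases i <;> simp [gammaOcto]) fun _ => rfl⟩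

/-- `γ'` as an element of `F₄`. -/
def γ' : F4 :=
  ⟨⟨entrywise gammaOcto', entrywise gammaOcto', entrywise_sq _ gammaOcto'_sq,
      entrywise_sq _ gammaOcto'_sq⟩,
    freudenthal_entrywise gammaOcto' gammaOcto'_mul
      (fun x => Octo.ext rfl fun i => by fin_cases i <;> simp [gammaOcto'])
      (fun r => Octo.ext rfl fun i => by fin_cases i <;> simp [gammaOcto']) fun _ => rfl⟩

/-- The complex conjugation `γ₁` as an element of `F₄`. -/
def γ₁ : F4 :=
  ⟨⟨entrywise gammaOcto₁, entrywise gammaOcto₁, entrywise_sq _ gammaOcto₁_sq,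
      entrywise_sq _ gammaOcto₁_sq⟩,
    freudenthal_entrywise gammaOcto₁ gammaOcto₁_mul
      (fun x => Octo.ext rfl fun i => by simp [gammaOcto₁])
      (fun r => Octo.ext (by simp [gammaOcto₁]) fun i => by simp [gammaOcto₁]) fun _ => rfl⟩

/-- `σ` as an element of `F₄`. -/
def σ : F4 := ⟨⟨sigmaMap, sigmaMap, sigmaMap_sq, sigmaMap_sq⟩, freudenthal_sigmaMap⟩

/-- `σ'` as an element of `F₄`. -/
def σ' : F4 := ⟨⟨sigmaMap', sigmaMap', sigmaMap'_sq, sigmaMap'_sq⟩, freudenthal_sigmaMap'⟩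

/-- `F₄` contains `G₂` as the group of the entrywise applied automorphisms of the octonions. -/
def InG2 (α : F4) : Prop := ∃ g ∈ G2, (α : (Jord →L[ℝ] Jord)ˣ).1 = entrywise g.1

/-- The common fixed-point subgroup `(F₄)^{γ,γ',σ,σ'}`: the elements of `F₄` that commute with
`γ`, `γ'`, `σ` and `σ'`. -/
def fixedSubgroup : Subgroup F4 := Subgroup.centralizer {γ, γ', σ, σ'}

/-! ## Tori, and the semidirect product with a group of order two -/

/-- The identity component of a subgroup `H` of a topological group `G`, as a subgroup of `G`. -/
def identityComponent {G : Type*} [Group G] [TopologicalSpace G] [IsTopologicalGroup G]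
    (H : Subgroup G) : Subgroup G :=
  (Subgroup.connectedComponentOfOne H).map H.subtype

/-- A torus in a topological group: a subgroup isomorphic, as a topological group, to a power
of the circle group. -/
def IsTorus {G : Type*} [Group G] [TopologicalSpace G] (T : Subgroup G) : Prop :=
  ∃ n : ℕ, Nonempty (T ≃ₜ* (Fin n → Circle))

/-- A maximal torus: a torus that is not properly contained in another torus. -/
def IsMaximalTorus {G : Type*} [Group G] [TopologicalSpace G] (T : Subgroup G) : Prop :=
  Maximal IsTorus T

/-- The group `ℤ₂`. -/
abbrev Z2 : Type := Multiplicative (ZMod 2)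

/-- The action of `ℤ₂` on the torus `U(1)^{×4}` by simultaneous complex conjugation of the
four coordinates; on the unit circle, complex conjugation is inversion. -/
def conjAction : Z2 →* MulAut (Fin 4 → Circle) where
  toFun ε := if ε = 1 then 1 else MulEquiv.inv (Fin 4 → Circle)
  map_one' := if_pos rfl
  map_mul' a b := by
    have h : ∀ c : Z2, c = 1 ∨ c = Multiplicative.ofAdd 1 := by decide
    have h1 : (Multiplicative.ofAdd (1 : ZMod 2)) ≠ 1 := by decide
    have h2 : (Multiplicative.ofAdd (1 : ZMod 2)) * Multiplicative.ofAdd 1 = 1 := by decide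
    rcases h a with rfl | rfl <;> rcases h b with rfl | rfl
    · simp
    · simp
    · simp
    · rw [h2, if_pos rfl, if_neg h1]
      ext z
      simp

/-- The semidirect product `U(1)^{×4} · ℤ₂`. -/
abbrev TorusZ2 : Type := (Fin 4 → Circle) ⋊[conjAction] Z2

/-- The product topology of the semidirect product (`ℤ₂` is discrete). -/
instance : TopologicalSpace TorusZ2 :=
  TopologicalSpace.induced (SemidirectProduct.equivProd (φ := conjAction)) inferInstance

end ExcF4
end

/-!
The group `K` is determined by the eigenspaces of the four involutions. Those of `σ` and `σ'` are
the diagonal of `𝔍` and the three spaces of octonions `xᵢ`, so `α ∈ K` preserves each of them.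
A diagonal element `D` multiplies the `i`-th octonion space by `-Dᵢ / 2` in the Freudenthal product
(`freudenthal_diag_offSingle`), so `α` is the identity on the diagonal (`apply_of_off_eq_zero`), and
the Freudenthal products of octonion entries say that `α` is given by three norm preserving maps
`α₀, α₁, α₂` of the octonions with `αᵢ (conj (x y)) = conj (αᵢ₊₁ x · αᵢ₊₂ y)`
(`block_re_mul_star`, `block_triality`); indices are taken in `Fin 3`.

The eigenspaces of `γ` and `γ'` in the octonions are the four summands `ℂ` of `ℂ ⊕ ℂ³`, so each `αᵢ`
consists of four real-linear maps of `ℂ`. By triality the block of `α₀` on `ℂ`, divided by its value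
at `1`, is an `ℝ`-algebra endomorphism of `ℂ`, hence the identity or the conjugation
(`scalBlock_zero_eq_or`). In the first case triality makes all twelve blocks multiplications by
complex numbers of modulus one, with relations that leave exactly four of them free
(`mem_range_torusHom_of_linear`); the second case reduces to the first by multiplication by `γ₁`.
Conversely, those relations suffice for an element of `F₄`
(`IsTriality.diagonalMap_freudenthal`), which gives an injective homomorphism
`torusHom : U(1)^{×4} → K`, on whose image `γ₁` acts by inversion. So `(z, ε) ↦ torusHom z * γ₁ ^ ε`
is a continuous bijective homomorphism from a compact group to `K`, hence a homeomorphism.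

The image of the torus is connected, and clopen in `K`, so it is `K₀`. It contains `γ`, `γ'`, `σ`,
`σ'`, so a torus of `F₄` that contains it commutes with these, lies in `K`, and by connectedness in
`K₀`.
-/

noncomputable section

open scoped Matrix

namespace ExcF4

/-! ### The Freudenthal product in coordinates -/

/-- The indices of `Fin 3` are cyclic; the last term is the inner product `Re (xᵢ ȳᵢ)` of the
octonions. -/
theorem freudenthal_diag (X Y : Jord) (i : Fin 3) :
    (Jord.freudenthal X Y).diag i =
      (X.diag (i + 1) * Y.diag (i + 2) + X.diag (i + 2) * Y.diag (i + 1)) / 2 -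
        (X.off i * star (Y.off i)).re := by
  have hc : ∀ i k, crossProduct (Y.off i).vect (X.off i).vect k =
      -crossProduct (X.off i).vect (Y.off i).vect k := fun i k =>
    (congrFun (cross_anticomm _ _) k).symm
  fin_cases i <;> simp [Jord.freudenthal, Jord.inn, Jord.tr, Jord.unit, Jord.jordan,
    Jord.ofMatrix, Jord.toMatrix, Matrix.mul_apply, Fin.sum_univ_three, Octo.re, dotProduct] <;>
    ring

theorem freudenthal_off (X Y : Jord) (i : Fin 3) :
    (Jord.freudenthal X Y).off i =
      (1 / 2 : ℝ) • (star (X.off (i + 1) * Y.off (i + 2)) + star (Y.off (i + 1) * X.off (i + 2))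
        - X.diag i • Y.off i - Y.diag i • X.off i) := by
  fin_cases i <;> ext k
  all_goals try fin_cases k
  all_goals simp [Jord.freudenthal, Jord.inn, Jord.tr, Jord.unit, Jord.jordan, crossProduct,
    Jord.ofMatrix, Jord.toMatrix, Matrix.mul_apply, Fin.sum_univ_three, dotProduct, Matrix.vecHead, Matrix.vecTail]
  all_goals ring

/-! ### The diagonal torus -/

/-- The operator of `𝔍` that fixes the diagonal and multiplies the `ℂ`-component of `xᵢ` by
`c.1 i` and the `k`-th coordinate of its `ℂ³`-component by `c.2 i k`. -/
def diagonalMap (c : (Fin 3 → Circle) × (Fin 3 → Fin 3 → Circle)) : Jord →L[ℝ] Jord :=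
  LinearMap.toContinuousLinearMap
    { toFun := fun X => Jord.mk X.diag fun i =>
        Octo.mk (c.1 i * (X.off i).scal) fun k => c.2 i k * (X.off i).vect k
      map_add' := by
        intro X Y
        ext i
        · rfl
        · simp [mul_add]
        · simp [mul_add]
      map_smul' := by
        intro r X
        ext i
        · rfl
        · simp [mul_left_comm]
        · simp [mul_left_comm] }

@[simp] theorem diagonalMap_diag (c X) : (diagonalMap c X).diag = X.diag := rfl

@[simp] theorem diagonalMap_scal (c X i) :
    ((diagonalMap c X).off i).scal = c.1 i * (X.off i).scal := rfl

@[simp] theorem diagonalMap_vect (c X i k) :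
    ((diagonalMap c X).off i).vect k = c.2 i k * (X.off i).vect k := rfl

/-- `diagonalMap` as a homomorphism to the group of invertible operators. -/
def diagonalHom : (Fin 3 → Circle) × (Fin 3 → Fin 3 → Circle) →* (Jord →L[ℝ] Jord)ˣ :=
  MonoidHom.toHomUnits
    { toFun := diagonalMap
      map_one' := by
        refine ContinuousLinearMap.ext fun X => ?_
        ext <;> simp
      map_mul' := by
        intro c d
        refine ContinuousLinearMap.ext fun X => ?_
        ext <;> simp [mul_assoc] }

theorem diagonalHom_val (c) : (diagonalHom c).1 = diagonalMap c := rfl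

theorem continuous_diagonalMap : Continuous diagonalMap := by
  refine continuous_clm_apply.2 fun X => ?_
  change Continuous fun c : (Fin 3 → Circle) × (Fin 3 → Fin 3 → Circle) =>
    ((X.diag, fun i => ((c.1 i * (X.off i).scal : ℂ), fun k => (c.2 i k * (X.off i).vect k : ℂ))) :
      (Fin 3 → ℝ) × (Fin 3 → ℂ × (Fin 3 → ℂ)))
  fun_prop

theorem continuous_diagonalHom : Continuous diagonalHom := by
  refine Units.continuous_iff.2 ⟨continuous_diagonalMap, ?_⟩
  have h : (fun c => ((diagonalHom c)⁻¹).1) = fun c => diagonalMap c⁻¹ := by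
    funext c
    rw [← map_inv, diagonalHom_val]
  change Continuous fun c => ((diagonalHom c)⁻¹).1
  rw [h]
  exact continuous_diagonalMap.comp continuous_inv

/-- The relations under which the three octonionic multiplications defined by `c` form a triality
triple, `αᵢ(conj (x y)) = conj (αᵢ₊₁ x αᵢ₊₂ y)`. -/
structure IsTriality (c : (Fin 3 → Circle) × (Fin 3 → Fin 3 → Circle)) : Prop where
  scal_scal : ∀ i, c.1 i * (c.1 (i + 1) * c.1 (i + 2)) = 1
  scal_vect : ∀ i k, c.1 i * c.2 (i + 1) k = c.2 (i + 2) k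
  cross : ∀ i k, c.2 i k * (c.2 (i + 1) (k + 1) * c.2 (i + 2) (k + 2)) = 1
  cross' : ∀ i k, c.2 i k * (c.2 (i + 1) (k + 2) * c.2 (i + 2) (k + 1)) = 1

theorem IsTriality.diagonalMap_freudenthal {c} (hc : IsTriality c) (X Y : Jord) :
    diagonalMap c (Jord.freudenthal X Y) =
      Jord.freudenthal (diagonalMap c X) (diagonalMap c Y) := by
  -- Each relation is used in the form "coefficient = conjugate of a product of coefficients".
  have hn : ∀ z : Circle, (z : ℂ) * (starRingEnd ℂ) z = 1 := fun z => by
    rw [Complex.mul_conj, Circle.normSq_coe, Complex.ofReal_one]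
  have h1 : ∀ i, (c.1 i : ℂ) =
      (starRingEnd ℂ) (c.1 (i + 1)) * (starRingEnd ℂ) (c.1 (i + 2)) := fun i => by
    have := eq_inv_of_mul_eq_one_left (hc.scal_scal i)
    rw [this, Circle.coe_inv_eq_conj, Circle.coe_mul, map_mul]
  have h2 : ∀ i k, (c.1 i : ℂ) = (starRingEnd ℂ) (c.2 (i + 1) k) * c.2 (i + 2) k := fun i k => by
    have := eq_mul_inv_of_mul_eq (hc.scal_vect i k)
    rw [this, Circle.coe_mul, Circle.coe_inv_eq_conj, mul_comm]
  have h3 : ∀ i k, (c.2 i k : ℂ) = c.1 (i + 1) * c.2 (i + 2) k := fun i k => by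
    have := hc.scal_vect (i + 1) k
    rw [add_assoc, add_assoc, show (1 + 1 : Fin 3) = 2 from rfl, show (1 + 2 : Fin 3) = 0 from rfl,
      add_zero] at this
    rw [← Circle.coe_mul, this]
  have h4 : ∀ i k, (c.2 i k : ℂ) = (starRingEnd ℂ) (c.1 (i + 2)) * c.2 (i + 1) k := fun i k => by
    have := hc.scal_vect (i + 2) k
    rw [add_assoc, add_assoc, show (2 + 1 : Fin 3) = 0 from rfl, show (2 + 2 : Fin 3) = 1 from rfl,
      add_zero] at this
    rw [← Circle.coe_inv_eq_conj, ← Circle.coe_mul, ← this, inv_mul_cancel_left]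
  have h5 : ∀ i k, (c.2 i k : ℂ) =
      (starRingEnd ℂ) (c.2 (i + 1) (k + 1)) * (starRingEnd ℂ) (c.2 (i + 2) (k + 2)) :=
    fun i k => by
    have := eq_inv_of_mul_eq_one_left (hc.cross i k)
    rw [this, Circle.coe_inv_eq_conj, Circle.coe_mul, map_mul]
  have h6 : ∀ i k, (c.2 i k : ℂ) =
      (starRingEnd ℂ) (c.2 (i + 1) (k + 2)) * (starRingEnd ℂ) (c.2 (i + 2) (k + 1)) :=
    fun i k => by
    have := eq_inv_of_mul_eq_one_left (hc.cross' i k)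
    rw [this, Circle.coe_inv_eq_conj, Circle.coe_mul, map_mul]
  have hre : ∀ (z : Circle) (a b : ℂ), z * a * (starRingEnd ℂ) (z * b) = a * (starRingEnd ℂ) b :=
    fun z a b => by
    rw [map_mul]
    linear_combination a * (starRingEnd ℂ) b * hn z
  have hmul : ∀ i (x y : Jord), star ((diagonalMap c x).off (i + 1) * (diagonalMap c y).off (i + 2))
      = Octo.mk (c.1 i * (star (x.off (i + 1) * y.off (i + 2))).scal)
        fun k => c.2 i k * (star (x.off (i + 1) * y.off (i + 2))).vect k := by
    intro i x y
    ext k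
    · simp only [Octo.scal_star, Octo.scal_mul, diagonalMap_scal, dotProduct, Fin.sum_univ_three,
        diagonalMap_vect, Octo.scal_mk, star_sub, star_add, star_mul', Pi.star_apply,
        RCLike.star_def, mul_sub, mul_add, RingHomCompTriple.comp_apply, RingHom.id_apply]
      linear_combination
        -(starRingEnd ℂ) (x.off (i + 1)).scal * (starRingEnd ℂ) (y.off (i + 2)).scal * h1 i
        + (starRingEnd ℂ) ((x.off (i + 1)).vect 0) * (y.off (i + 2)).vect 0 * h2 i 0
        + (starRingEnd ℂ) ((x.off (i + 1)).vect 1) * (y.off (i + 2)).vect 1 * h2 i 1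
        + (starRingEnd ℂ) ((x.off (i + 1)).vect 2) * (y.off (i + 2)).vect 2 * h2 i 2
    · have key : ∀ a b : Octo, ∀ k, crossProduct a.vect b.vect k =
          a.vect (k + 1) * b.vect (k + 2) - a.vect (k + 2) * b.vect (k + 1) := by
        intro a b k
        fin_cases k <;> simp [crossProduct]
      simp only [Octo.vect_star, Octo.vect_mul, Pi.neg_apply, Pi.add_apply, Pi.smul_apply,
        Pi.star_apply, key, diagonalMap_vect, diagonalMap_scal, Octo.vect_mk, smul_eq_mul,
        RCLike.star_def, map_mul, map_sub]
      linear_combination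
        (x.off (i + 1)).scal * (y.off (i + 2)).vect k * h3 i k
        + (starRingEnd ℂ) (y.off (i + 2)).scal * (x.off (i + 1)).vect k * h4 i k
        + (starRingEnd ℂ) ((x.off (i + 1)).vect (k + 1)) *
          (starRingEnd ℂ) ((y.off (i + 2)).vect (k + 2)) * h5 i k
        - (starRingEnd ℂ) ((x.off (i + 1)).vect (k + 2)) *
          (starRingEnd ℂ) ((y.off (i + 2)).vect (k + 1)) * h6 i k
  refine Jord.ext (fun i => ?_) fun i => ?_
  · rw [diagonalMap_diag, freudenthal_diag, freudenthal_diag]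
    simp only [diagonalMap_diag, Octo.re, Octo.scal_mul, diagonalMap_scal, Octo.scal_star,
      Octo.vect_star, dotProduct, Pi.star_apply, Pi.neg_apply, star_neg, mul_neg,
      diagonalMap_vect, RCLike.star_def, hre]
  · have : (diagonalMap c (Jord.freudenthal X Y)).off i =
        Octo.mk (c.1 i * ((Jord.freudenthal X Y).off i).scal)
          fun k => c.2 i k * ((Jord.freudenthal X Y).off i).vect k := rfl
    rw [this, freudenthal_off, freudenthal_off, hmul, hmul]
    ext k
    · simp only [Octo.scal_mk, Octo.scal_smul, Octo.scal_sub, Octo.scal_add, diagonalMap_scal,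
        diagonalMap_diag]
      ring
    · simp only [Octo.vect_mk, Octo.vect_smul, Octo.vect_sub, Octo.vect_add, diagonalMap_vect,
        diagonalMap_diag, Pi.smul_apply, Pi.sub_apply, Pi.add_apply, Complex.real_smul]
      ring

/-- The coefficients of the diagonal torus, from four independent circle coordinates `p`, `q`,
`a₀`, `a₁`: the `ℂ`-components of `x₁`, `x₂`, `x₃` are multiplied by `p`, `q`, `(p q)⁻¹`, and the
`ℂ³`-components by `a`, `(p q)⁻¹ a`, `q⁻¹ a`, where `a₂` is forced by `a₀ a₁ a₂ = p q²`. -/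
def torusCoeff : (Fin 4 → Circle) →* (Fin 3 → Circle) × (Fin 3 → Fin 3 → Circle) :=
  let z : Fin 4 → (Fin 4 → Circle) →* Circle := Pi.evalMonoidHom _
  (MonoidHom.pi ![z 0, z 1, (z 0 * z 1)⁻¹]).prod
    (MonoidHom.pi fun i => MonoidHom.pi fun k =>
      ![1, (z 0 * z 1)⁻¹, (z 1)⁻¹] i * ![z 2, z 3, z 0 * z 1 ^ 2 * (z 2 * z 3)⁻¹] k)

theorem torusCoeff_scal (z : Fin 4 → Circle) (i : Fin 3) :
    (torusCoeff z).1 i = ![z 0, z 1, (z 0 * z 1)⁻¹] i := by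
  fin_cases i <;> rfl

theorem torusCoeff_vect (z : Fin 4 → Circle) (i k : Fin 3) :
    (torusCoeff z).2 i k = ![1, (z 0 * z 1)⁻¹, (z 1)⁻¹] i *
      ![z 2, z 3, z 0 * z 1 ^ 2 * (z 2 * z 3)⁻¹] k := by
  fin_cases i <;> fin_cases k <;> rfl

theorem isTriality_torusCoeff (z : Fin 4 → Circle) : IsTriality (torusCoeff z) := by
  constructor
  · intro i
    apply Circle.coe_injective
    fin_cases i <;> simp [torusCoeff_scal]
  · intro i k
    simp only [torusCoeff_vect, ← mul_assoc, torusCoeff_scal]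
    congr 1
    apply Circle.coe_injective
    fin_cases i <;> simp
  all_goals
    intro i k
    apply Circle.coe_injective
    fin_cases i <;> fin_cases k <;> simp [torusCoeff_vect] <;> field_simp

theorem continuous_torusCoeff : Continuous torusCoeff := by
  refine Continuous.prodMk (continuous_pi fun i => ?_)
    (continuous_pi fun i => continuous_pi fun k => ?_)
  · change Continuous fun z => (torusCoeff z).1 i
    simp only [torusCoeff_scal]
    fin_cases i <;> simp <;> fun_prop
  · change Continuous fun z => (torusCoeff z).2 i k
    simp only [torusCoeff_vect]
    fin_cases i <;> fin_cases k <;> simp <;> fun_prop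

/-- The four-dimensional torus of operators that are diagonal on the coordinates of `𝔍`. -/
def torusHom : (Fin 4 → Circle) →* F4 :=
  (diagonalHom.comp torusCoeff).codRestrict F4
    fun z => (isTriality_torusCoeff z).diagonalMap_freudenthal

theorem torusHom_val (z) : (torusHom z).1.1 = diagonalMap (torusCoeff z) := rfl

theorem continuous_torusHom : Continuous torusHom :=
  (continuous_diagonalHom.comp continuous_torusCoeff).subtype_mk _

/-- The coefficients are read off from the element all of whose off-diagonal coordinates are `1`. -/
theorem diagonalMap_injective : Function.Injective diagonalMap := by
  intro c d h
  have h1 : ∀ i, (diagonalMap c (Jord.mk 0 fun _ => Octo.mk 1 1)).off i =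
      (diagonalMap d (Jord.mk 0 fun _ => Octo.mk 1 1)).off i := fun i => by rw [h]
  refine Prod.ext (funext fun i => ?_) (funext fun i => funext fun k => ?_)
  · exact Circle.coe_injective (by simpa using congrArg Octo.scal (h1 i))
  · exact Circle.coe_injective (by simpa using congrFun (congrArg Octo.vect (h1 i)) k)

theorem torusHom_injective : Function.Injective torusHom := by
  intro z w h
  have h1 : torusCoeff z = torusCoeff w :=
    diagonalMap_injective (congrArg (fun α : F4 => α.1.1) h)
  have hs : ∀ i, (torusCoeff z).1 i = (torusCoeff w).1 i := fun i => by rw [h1]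
  have hv : ∀ k, (torusCoeff z).2 0 k = (torusCoeff w).2 0 k := fun k => by rw [h1]
  funext i
  fin_cases i
  · simpa [torusCoeff_scal] using hs 0
  · simpa [torusCoeff_scal] using hs 1
  · simpa [torusCoeff_vect] using hv 0
  · simpa [torusCoeff_vect] using hv 1

theorem F4_ext {α β : F4} (h : ∀ X, α.1.1 X = β.1.1 X) : α = β :=
  Subtype.ext (Units.ext (ContinuousLinearMap.ext h))

/-! ### The involutions in the torus -/

theorem γ_eq_torusHom : γ = torusHom ![1, 1, 1, -1] := by
  refine F4_ext fun X => ?_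
  rw [torusHom_val]
  refine Jord.ext (fun i => rfl) fun i => Octo.ext ?_ fun k => ?_
  · simp only [diagonalMap_scal, torusCoeff_scal]
    fin_cases i <;> simp [γ, entrywise, gammaOcto]
  · simp only [diagonalMap_vect, torusCoeff_vect]
    fin_cases i <;> fin_cases k <;> simp [γ, entrywise, gammaOcto]

theorem γ'_eq_torusHom : γ' = torusHom ![1, 1, -1, 1] := by
  refine F4_ext fun X => ?_
  rw [torusHom_val]
  refine Jord.ext (fun i => rfl) fun i => Octo.ext ?_ fun k => ?_
  · simp only [diagonalMap_scal, torusCoeff_scal]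
    fin_cases i <;> simp [γ', entrywise, gammaOcto']
  · simp only [diagonalMap_vect, torusCoeff_vect]
    fin_cases i <;> fin_cases k <;> simp [γ', entrywise, gammaOcto']

theorem σ_eq_torusHom : σ = torusHom ![1, -1, 1, 1] := by
  refine F4_ext fun X => ?_
  rw [torusHom_val]
  refine Jord.ext (fun i => rfl) fun i => Octo.ext ?_ fun k => ?_
  · simp only [diagonalMap_scal, torusCoeff_scal]
    fin_cases i <;> simp [σ, sigmaMap]
  · simp only [diagonalMap_vect, torusCoeff_vect]
    fin_cases i <;> fin_cases k <;> simp [σ, sigmaMap]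

theorem σ'_eq_torusHom : σ' = torusHom ![-1, -1, -1, -1] := by
  refine F4_ext fun X => ?_
  rw [torusHom_val]
  refine Jord.ext (fun i => rfl) fun i => Octo.ext ?_ fun k => ?_
  · simp only [diagonalMap_scal, torusCoeff_scal]
    fin_cases i <;> simp [σ', sigmaMap']
  · simp only [diagonalMap_vect, torusCoeff_vect]
    fin_cases i <;> fin_cases k <;> simp [σ', sigmaMap']

theorem γ₁_apply_scal (X : Jord) (i : Fin 3) :
    ((γ₁.1.1 X).off i).scal = star (X.off i).scal := rfl

theorem γ₁_apply_vect (X : Jord) (i k : Fin 3) :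
    ((γ₁.1.1 X).off i).vect k = star ((X.off i).vect k) := rfl

theorem γ₁_mul_γ₁ : γ₁ * γ₁ = 1 :=
  Subtype.ext (Units.ext (entrywise_sq _ gammaOcto₁_sq))

/-- Conjugation by `γ₁` conjugates the coefficients, which inverts them on the unit circle. -/
theorem γ₁_mul_torusHom (z : Fin 4 → Circle) : γ₁ * torusHom z = torusHom z⁻¹ * γ₁ := by
  refine F4_ext fun X => ?_
  change γ₁.1.1 ((torusHom z).1.1 X) = (torusHom z⁻¹).1.1 (γ₁.1.1 X)
  rw [torusHom_val, torusHom_val, map_inv]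
  refine Jord.ext (fun i => rfl) fun i => Octo.ext ?_ fun k => ?_
  · simp [-Circle.coe_inv, γ₁_apply_scal, Circle.coe_inv_eq_conj]
  · simp [-Circle.coe_inv, γ₁_apply_vect, Circle.coe_inv_eq_conj]

/-- On a `ℂ`-component, an element of the torus is complex linear and `γ₁` is antilinear. -/
theorem torusHom_ne_γ₁ (z : Fin 4 → Circle) : torusHom z ≠ γ₁ := by
  intro h
  have h1 : ∀ X : Jord, (((torusHom z).1.1 X).off 0).scal = ((γ₁.1.1 X).off 0).scal :=
    fun X => by rw [h]
  have e1 := h1 (Jord.mk 0 fun _ => Octo.mk 1 0)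
  have e2 := h1 (Jord.mk 0 fun _ => Octo.mk Complex.I 0)
  rw [torusHom_val, diagonalMap_scal, γ₁_apply_scal] at e1 e2
  simp only [Jord.off_mk, Octo.scal_mk, mul_one, star_one] at e1 e2
  rw [e1] at e2
  have := congrArg Complex.im e2
  norm_num at this

theorem γ₁_commute_torusHom {z : Fin 4 → Circle} (hz : z⁻¹ = z) :
    Commute γ₁ (torusHom z) := by
  rw [Commute, SemiconjBy, γ₁_mul_torusHom, hz]

/-- The involutions `γ`, `γ'`, `σ`, `σ'` come from nontrivial elements of order two of the torus. -/
theorem mem_range_torusHom {τ : F4} (h : τ ∈ ({γ, γ', σ, σ'} : Set F4)) :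
    ∃ z, z⁻¹ = z ∧ z ≠ 1 ∧ torusHom z = τ := by
  have h1 : (-1 : Circle) ≠ 1 := fun h => by
    have := congrArg (fun z : Circle => (z : ℂ).re) h
    norm_num at this
  have hi : ∀ a b c d : Circle, (![a, b, c, d])⁻¹ = ![a⁻¹, b⁻¹, c⁻¹, d⁻¹] := by
    intro a b c d
    funext i
    fin_cases i <;> rfl
  rcases h with rfl | rfl | rfl | rfl
  · exact ⟨_, by simp [hi], fun h => h1 (congrFun h 3), γ_eq_torusHom.symm⟩
  · exact ⟨_, by simp [hi], fun h => h1 (congrFun h 2), γ'_eq_torusHom.symm⟩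
  · exact ⟨_, by simp [hi], fun h => h1 (congrFun h 1), σ_eq_torusHom.symm⟩
  · exact ⟨_, by simp [hi], fun h => h1 (congrFun h 0), σ'_eq_torusHom.symm⟩

theorem torusHom_mem_fixedSubgroup (z : Fin 4 → Circle) : torusHom z ∈ fixedSubgroup := by
  refine Subgroup.mem_centralizer_iff.2 fun τ hτ => ?_
  obtain ⟨w, -, -, rfl⟩ := mem_range_torusHom hτ
  rw [← map_mul, ← map_mul, mul_comm]

theorem γ₁_mem_fixedSubgroup : γ₁ ∈ fixedSubgroup := by
  refine Subgroup.mem_centralizer_iff.2 fun τ hτ => ?_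
  obtain ⟨w, hw, -, rfl⟩ := mem_range_torusHom hτ
  exact (γ₁_commute_torusHom hw).symm

theorem mem_insert_γ₁ {τ : F4} (h : τ ∈ ({γ, γ', σ, σ', γ₁} : Set F4)) :
    τ = γ₁ ∨ τ ∈ ({γ, γ', σ, σ'} : Set F4) := by
  simp only [Set.mem_insert_iff, Set.mem_singleton_iff] at h ⊢
  tauto

theorem orderOf_involution {τ : F4} (h : τ ∈ ({γ, γ', σ, σ', γ₁} : Set F4)) :
    orderOf τ = 2 := by
  refine orderOf_eq_prime ?_ ?_
  · rcases mem_insert_γ₁ h with rfl | h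
    · rw [sq, γ₁_mul_γ₁]
    · obtain ⟨z, hz, -, rfl⟩ := mem_range_torusHom h
      rw [sq, ← map_mul]
      nth_rewrite 1 [← hz]
      rw [inv_mul_cancel, map_one]
  · rcases mem_insert_γ₁ h with rfl | h
    · exact fun h => torusHom_ne_γ₁ 1 (by rw [map_one, h])
    · obtain ⟨z, -, hz, rfl⟩ := mem_range_torusHom h
      exact fun h => hz (torusHom_injective (by rw [h, map_one]))

theorem involution_comm {τ τ' : F4} (h : τ ∈ ({γ, γ', σ, σ', γ₁} : Set F4))
    (h' : τ' ∈ ({γ, γ', σ, σ', γ₁} : Set F4)) : τ * τ' = τ' * τ := by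
  rcases mem_insert_γ₁ h with rfl | h <;> rcases mem_insert_γ₁ h' with rfl | h'
  · rfl
  · exact Subgroup.mem_centralizer_iff.1 γ₁_mem_fixedSubgroup _ h' |>.symm
  · exact Subgroup.mem_centralizer_iff.1 γ₁_mem_fixedSubgroup _ h
  · obtain ⟨z, -, -, rfl⟩ := mem_range_torusHom h
    exact Subgroup.mem_centralizer_iff.1 (torusHom_mem_fixedSubgroup z) _ h' |>.symm

theorem inG2_γ : InG2 γ :=
  ⟨⟨gammaOcto, gammaOcto, gammaOcto_sq, gammaOcto_sq⟩, gammaOcto_mul, rfl⟩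

theorem inG2_γ' : InG2 γ' :=
  ⟨⟨gammaOcto', gammaOcto', gammaOcto'_sq, gammaOcto'_sq⟩, gammaOcto'_mul, rfl⟩

theorem inG2_γ₁ : InG2 γ₁ :=
  ⟨⟨gammaOcto₁, gammaOcto₁, gammaOcto₁_sq, gammaOcto₁_sq⟩, gammaOcto₁_mul, rfl⟩

/-! ### Elements of the fixed subgroup in block form -/

/-- The element of `𝔍` whose only nonzero entry is the off-diagonal octonion `xᵢ = x`. -/
def offSingle (i : Fin 3) : Octo →ₗ[ℝ] Jord where
  toFun x := Jord.mk 0 (Pi.single i x)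
  map_add' x y := Jord.ext (fun _ => (add_zero (0 : ℝ)).symm)
    fun j => congrFun (Pi.single_add (f := fun _ : Fin 3 => Octo) i x y) j
  map_smul' r x := Jord.ext (fun _ => (smul_zero r).symm)
    fun j => congrFun (Pi.single_smul (f := fun _ : Fin 3 => Octo) i r x) j

@[simp] theorem offSingle_diag (i x) : (offSingle i x).diag = 0 := rfl

@[simp] theorem offSingle_off (i x) : (offSingle i x).off = Pi.single i x := rfl

/-- The diagonal block of an operator of `𝔍` on the `i`-th off-diagonal entry: the new `xᵢ` as a
function of the old one. -/
def block (f : Jord →L[ℝ] Jord) (i : Fin 3) : Octo →ₗ[ℝ] Octo where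
  toFun x := (f (offSingle i x)).off i
  map_add' x y := by rw [map_add, map_add]; rfl
  map_smul' r x := by rw [map_smul, map_smul]; rfl

theorem block_apply (f i x) : block f i x = (f (offSingle i x)).off i := rfl

theorem comm_apply {α τ : F4} (hα : α ∈ fixedSubgroup) (hτ : τ ∈ ({γ, γ', σ, σ'} : Set F4))
    (X : Jord) : α.1.1 (τ.1.1 X) = τ.1.1 (α.1.1 X) :=
  congrArg (fun β : F4 => β.1.1 X) (Subgroup.mem_centralizer_iff.1 hα τ hτ).symm

theorem F4_freudenthal (α : F4) (X Y : Jord) :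
    α.1.1 (Jord.freudenthal X Y) = Jord.freudenthal (α.1.1 X) (α.1.1 Y) := α.2 X Y

theorem F4_injective (α : F4) : Function.Injective α.1.1 := by
  intro X Y h
  have h1 : ∀ Z, α.1⁻¹.1 (α.1.1 Z) = Z := fun Z => congrArg (fun f => f Z) α.1.inv_mul
  rw [← h1 X, h, h1]

theorem octo_eq_zero_of_neg_eq {x : Octo} (h : -x = x) : x = 0 := by
  have : (2 : ℝ) • x = 0 := by
    rw [two_smul]
    nth_rewrite 1 [← h]
    exact neg_add_cancel x
  exact (smul_eq_zero.1 this).resolve_left two_ne_zero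

theorem σ_diag (X : Jord) : (σ.1.1 X).diag = X.diag := rfl
theorem σ'_diag (X : Jord) : (σ'.1.1 X).diag = X.diag := rfl
theorem σ_off (X : Jord) : (σ.1.1 X).off = ![X.off 0, -X.off 1, -X.off 2] := rfl
theorem σ'_off (X : Jord) : (σ'.1.1 X).off = ![-X.off 0, -X.off 1, X.off 2] := rfl

variable {α : F4}

/-- The diagonal of `𝔍` is the common fixed space of `σ` and `σ'`. -/
theorem off_apply_of_off_eq_zero (hα : α ∈ fixedSubgroup) {X : Jord} (hX : X.off = 0) :
    (α.1.1 X).off = 0 := by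
  have e1 : σ.1.1 X = X := Jord.ext (fun _ => rfl) fun i => by
    rw [σ_off, hX]
    fin_cases i <;> simp
  have e2 : σ'.1.1 X = X := Jord.ext (fun _ => rfl) fun i => by
    rw [σ'_off, hX]
    fin_cases i <;> simp
  have h1 := comm_apply hα (τ := σ) (by simp) X
  have h2 := comm_apply hα (τ := σ') (by simp) X
  rw [e1] at h1
  rw [e2] at h2
  have k1 := congrArg Jord.off h1
  have k2 := congrArg Jord.off h2
  rw [σ_off] at k1
  rw [σ'_off] at k2
  funext i
  fin_cases i
  · exact octo_eq_zero_of_neg_eq (congrFun k2 0).symm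
  · exact octo_eq_zero_of_neg_eq (congrFun k1 1).symm
  · exact octo_eq_zero_of_neg_eq (congrFun k1 2).symm

/-- The three off-diagonal octonions are the other simultaneous eigenspaces of `σ` and `σ'`. -/
theorem apply_offSingle (hα : α ∈ fixedSubgroup) (i : Fin 3) (x : Octo) :
    α.1.1 (offSingle i x) = offSingle i (block α.1.1 i x) := by
  have h1 := comm_apply hα (τ := σ) (by simp) (offSingle i x)
  have h2 := comm_apply hα (τ := σ') (by simp) (offSingle i x)
  have e1 : σ.1.1 (offSingle i x) = (![1, -1, -1] i : ℝ) • offSingle i x :=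
    Jord.ext (fun j => by simp [σ_diag]) fun j => by
      rw [σ_off, Jord.off_smul, Pi.smul_apply, offSingle_off]
      fin_cases i <;> fin_cases j <;> simp
  have e2 : σ'.1.1 (offSingle i x) = (![-1, -1, 1] i : ℝ) • offSingle i x :=
    Jord.ext (fun j => by simp [σ'_diag]) fun j => by
      rw [σ'_off, Jord.off_smul, Pi.smul_apply, offSingle_off]
      fin_cases i <;> fin_cases j <;> simp
  rw [e1, map_smul] at h1
  rw [e2, map_smul] at h2
  set Y := α.1.1 (offSingle i x) with hY
  have d1 := fun j => congrFun (congrArg Jord.diag h1) j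
  have d2 := fun j => congrFun (congrArg Jord.diag h2) j
  have o1 := fun j => congrFun (congrArg Jord.off h1) j
  have o2 := fun j => congrFun (congrArg Jord.off h2) j
  simp only [σ_diag, Jord.diag_smul, Pi.smul_apply, smul_eq_mul] at d1
  simp only [σ'_diag, Jord.diag_smul, Pi.smul_apply, smul_eq_mul] at d2
  simp only [σ_off, Jord.off_smul, Pi.smul_apply] at o1
  simp only [σ'_off, Jord.off_smul, Pi.smul_apply] at o2
  refine Jord.ext (fun j => ?_) fun j => ?_
  · have := d1 j
    have := d2 j
    rw [offSingle_diag, Pi.zero_apply]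
    fin_cases i <;> simp at * <;> linarith
  · rw [offSingle_off, block_apply, ← hY]
    have hn : ∀ {x : Octo}, x = -x → x = 0 := fun h => octo_eq_zero_of_neg_eq h.symm
    have a0 := o1 0
    have a1 := o1 1
    have a2 := o1 2
    have b0 := o2 0
    have b1 := o2 1
    have b2 := o2 2
    fin_cases i <;> fin_cases j <;> simp at a0 a1 a2 b0 b1 b2 ⊢ <;>
      first
        | exact hn a0
        | exact hn a1
        | exact hn a2
        | exact hn b0
        | exact hn b1
        | exact hn b2
        | exact octo_eq_zero_of_neg_eq a0
        | exact octo_eq_zero_of_neg_eq a1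
        | exact octo_eq_zero_of_neg_eq a2
        | exact octo_eq_zero_of_neg_eq b0
        | exact octo_eq_zero_of_neg_eq b1
        | exact octo_eq_zero_of_neg_eq b2

theorem block_ne_zero (hα : α ∈ fixedSubgroup) (i : Fin 3) {x : Octo} (hx : x ≠ 0) :
    block α.1.1 i x ≠ 0 := by
  intro h
  have h1 := apply_offSingle hα i x
  rw [h, map_zero, ← map_zero α.1.1] at h1
  have h2 := congrFun (congrArg Jord.off (F4_injective α h1)) i
  rw [offSingle_off, Pi.single_eq_same] at h2
  exact hx h2

theorem freudenthal_diag_offSingle {D : Jord} (hD : D.off = 0) (i : Fin 3) (x : Octo) :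
    Jord.freudenthal D (offSingle i x) = (-(D.diag i) / 2) • offSingle i x := by
  refine Jord.ext (fun j => ?_) fun j => ?_
  · rw [freudenthal_diag, hD]
    simp [Octo.re]
  · rw [freudenthal_off, hD]
    ext k
    · by_cases h : j = i
      · subst h
        simp
        ring
      · simp [h]
    · by_cases h : j = i
      · subst h
        simp
        ring
      · simp [h]

/-- Multiplication by a diagonal element `D` scales the `i`-th off-diagonal space by `-Dᵢ / 2`,
so the action on the off-diagonal spaces determines the one on the diagonal. -/
theorem apply_of_off_eq_zero (hα : α ∈ fixedSubgroup) {X : Jord} (hX : X.off = 0) :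
    α.1.1 X = X := by
  have h0 := off_apply_of_off_eq_zero hα hX
  refine Jord.ext (fun i => ?_) fun i => by rw [h0, hX]
  have hx : Octo.ofReal 1 ≠ 0 := fun h => by
    have := congrArg Octo.scal h
    simp at this
  have hb := block_ne_zero hα i hx
  have h1 := F4_freudenthal α X (offSingle i (Octo.ofReal 1))
  rw [apply_offSingle hα, freudenthal_diag_offSingle hX, freudenthal_diag_offSingle h0, map_smul,
    apply_offSingle hα] at h1
  have h2 := congrFun (congrArg Jord.off h1) i
  simp only [Jord.off_smul, Pi.smul_apply, offSingle_off, Pi.single_eq_same] at h2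
  have := smul_left_injective ℝ hb h2
  linarith

theorem apply_eq_blocks (hα : α ∈ fixedSubgroup) (X : Jord) :
    α.1.1 X = Jord.mk X.diag fun i => block α.1.1 i (X.off i) := by
  have h : X = Jord.mk X.diag 0 + ∑ i, offSingle i (X.off i) := by
    rw [Fin.sum_univ_three]
    refine Jord.ext (fun j => ?_) fun j => ?_
    · simp
    · fin_cases j <;> simp
  have hD : α.1.1 (Jord.mk X.diag 0) = Jord.mk X.diag 0 := apply_of_off_eq_zero hα rfl
  conv_lhs => rw [h]
  rw [map_add, map_sum, hD, Fin.sum_univ_three]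
  simp only [apply_offSingle hα]
  refine Jord.ext (fun j => ?_) fun j => ?_
  · simp
  · fin_cases j <;> simp

/-- The blocks of an element of the fixed subgroup preserve the norm of the octonions. -/
theorem block_re_mul_star (hα : α ∈ fixedSubgroup) (i : Fin 3) (x y : Octo) :
    (block α.1.1 i x * star (block α.1.1 i y)).re = (x * star y).re := by
  have h1 := F4_freudenthal α (offSingle i x) (offSingle i y)
  have h2 := congrFun (congrArg Jord.diag h1) i
  rw [apply_eq_blocks hα, apply_offSingle hα, apply_offSingle hα, Jord.diag_mk, freudenthal_diag,
    freudenthal_diag] at h2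
  simpa using h2.symm

/-- The blocks of an element of the fixed subgroup form a triality triple. -/
theorem block_triality (hα : α ∈ fixedSubgroup) (i : Fin 3) (x y : Octo) :
    block α.1.1 i (star (x * y)) = star (block α.1.1 (i + 1) x * block α.1.1 (i + 2) y) := by
  have h1 := F4_freudenthal α (offSingle (i + 1) x) (offSingle (i + 2) y)
  have h2 := congrFun (congrArg Jord.off h1) i
  rw [apply_eq_blocks hα, apply_offSingle hα, apply_offSingle hα, Jord.off_mk, freudenthal_off,
    freudenthal_off] at h2
  have z1 : ∀ x : Octo, x * 0 = 0 := fun x => by ext <;> simp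
  have z2 : ∀ x : Octo, 0 * x = 0 := fun x => by ext <;> simp
  have z3 : star (0 : Octo) = 0 := by ext <;> simp
  have n1 : i + 1 ≠ i + 2 := fun h => absurd (add_left_cancel h) (by decide)
  have n2 : i + 2 ≠ i + 1 := n1.symm
  simp only [offSingle_off, Pi.single_eq_same, offSingle_diag, Pi.zero_apply, zero_smul, sub_zero,
    Pi.single_eq_of_ne n1, z2, z3, add_zero, map_smul] at h2
  exact smul_right_injective Octo (by norm_num) h2

/-! ### The twelve complex blocks -/

/-- The action of an operator of `𝔍` on the `ℂ`-component of `xᵢ`. -/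
def scalBlock (f : Jord →L[ℝ] Jord) (i : Fin 3) : ℂ →ₗ[ℝ] ℂ where
  toFun a := (block f i (Octo.mk a 0)).scal
  map_add' a b := by
    have h : Octo.mk (a + b) 0 = Octo.mk a 0 + Octo.mk b 0 :=
      Octo.ext rfl fun k => (add_zero (0 : ℂ)).symm
    rw [h, map_add, Octo.scal_add]
  map_smul' r a := by
    have h : Octo.mk (r • a) 0 = r • Octo.mk a 0 := Octo.ext rfl fun k => (smul_zero r).symm
    rw [h, map_smul, Octo.scal_smul, RingHom.id_apply, Complex.real_smul]

/-- The action of an operator of `𝔍` on the `k`-th coordinate of the `ℂ³`-component of `xᵢ`. -/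
def vectBlock (f : Jord →L[ℝ] Jord) (i k : Fin 3) : ℂ →ₗ[ℝ] ℂ where
  toFun z := (block f i (Octo.mk 0 (Pi.single k z))).vect k
  map_add' z w := by
    have h : Octo.mk 0 (Pi.single k (z + w)) =
        Octo.mk 0 (Pi.single k z) + Octo.mk 0 (Pi.single k w) :=
      Octo.ext (add_zero (0 : ℂ)).symm
        fun l => congrFun (Pi.single_add (f := fun _ : Fin 3 => ℂ) k z w) l
    rw [h, map_add, Octo.vect_add, Pi.add_apply]
  map_smul' r z := by
    have h : Octo.mk 0 (Pi.single k (r • z)) = r • Octo.mk 0 (Pi.single k z) :=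
      Octo.ext (smul_zero r).symm
        fun l => congrFun (Pi.single_smul (f := fun _ : Fin 3 => ℂ) k r z) l
    rw [h, map_smul, Octo.vect_smul, RingHom.id_apply, Pi.smul_apply]

theorem vectBlock_apply (f i k z) :
    vectBlock f i k z = (block f i (Octo.mk 0 (Pi.single k z))).vect k := rfl

theorem gammaOcto_eq (x : Octo) :
    gammaOcto x = Octo.mk x.scal ![x.vect 0, -x.vect 1, -x.vect 2] := rfl

theorem gammaOcto'_eq (x : Octo) :
    gammaOcto' x = Octo.mk x.scal ![-x.vect 0, x.vect 1, -x.vect 2] := rfl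

theorem block_gammaOcto (hα : α ∈ fixedSubgroup) (i : Fin 3) (x : Octo) :
    block α.1.1 i (gammaOcto x) = gammaOcto (block α.1.1 i x) := by
  have h := comm_apply hα (τ := γ) (by simp) (offSingle i x)
  have e : γ.1.1 (offSingle i x) = offSingle i (gammaOcto x) :=
    Jord.ext (fun _ => rfl) fun j => by
      change gammaOcto ((Pi.single i x : Fin 3 → Octo) j) = (Pi.single i _ : Fin 3 → Octo) j
      exact Pi.apply_single (fun _ => gammaOcto) (fun _ => map_zero _) i x j
  rw [e] at h
  exact congrFun (congrArg Jord.off h) i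

theorem block_gammaOcto' (hα : α ∈ fixedSubgroup) (i : Fin 3) (x : Octo) :
    block α.1.1 i (gammaOcto' x) = gammaOcto' (block α.1.1 i x) := by
  have h := comm_apply hα (τ := γ') (by simp) (offSingle i x)
  have e : γ'.1.1 (offSingle i x) = offSingle i (gammaOcto' x) :=
    Jord.ext (fun _ => rfl) fun j => by
      change gammaOcto' ((Pi.single i x : Fin 3 → Octo) j) = (Pi.single i _ : Fin 3 → Octo) j
      exact Pi.apply_single (fun _ => gammaOcto') (fun _ => map_zero _) i x j
  rw [e] at h
  exact congrFun (congrArg Jord.off h) i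

/-- The component `ℂ` of the octonions is the common fixed space of `γ` and `γ'`. -/
theorem block_mk_zero (hα : α ∈ fixedSubgroup) (i : Fin 3) (a : ℂ) :
    block α.1.1 i (Octo.mk a 0) = Octo.mk (scalBlock α.1.1 i a) 0 := by
  have h1 := block_gammaOcto hα i (Octo.mk a 0)
  have h2 := block_gammaOcto' hα i (Octo.mk a 0)
  have e1 : gammaOcto (Octo.mk a 0) = Octo.mk a 0 := by
    ext k
    · rfl
    · fin_cases k <;> simp [gammaOcto_eq]
  have e2 : gammaOcto' (Octo.mk a 0) = Octo.mk a 0 := by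
    ext k
    · rfl
    · fin_cases k <;> simp [gammaOcto'_eq]
  rw [e1, gammaOcto_eq] at h1
  rw [e2, gammaOcto'_eq] at h2
  have v1 := congrArg Octo.vect h1
  have v2 := congrArg Octo.vect h2
  refine Octo.ext rfl fun k => ?_
  fin_cases k
  · exact self_eq_neg.1 (congrFun v2 0)
  · exact self_eq_neg.1 (congrFun v1 1)
  · exact self_eq_neg.1 (congrFun v1 2)

/-- The coordinate axes of `ℂ³` are the other simultaneous eigenspaces of `γ` and `γ'`. -/
theorem block_mk_single (hα : α ∈ fixedSubgroup) (i k : Fin 3) (z : ℂ) :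
    block α.1.1 i (Octo.mk 0 (Pi.single k z)) =
      Octo.mk 0 (Pi.single k (vectBlock α.1.1 i k z)) := by
  have h1 := block_gammaOcto hα i (Octo.mk 0 (Pi.single k z))
  have h2 := block_gammaOcto' hα i (Octo.mk 0 (Pi.single k z))
  have e1 : gammaOcto (Octo.mk 0 (Pi.single k z)) =
      (![1, -1, -1] k : ℝ) • Octo.mk 0 (Pi.single k z) := by
    ext l
    · simp [gammaOcto_eq]
    · rw [Octo.vect_smul, Pi.smul_apply]
      fin_cases k <;> fin_cases l <;> simp [gammaOcto_eq]
  have e2 : gammaOcto' (Octo.mk 0 (Pi.single k z)) =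
      (![-1, 1, -1] k : ℝ) • Octo.mk 0 (Pi.single k z) := by
    ext l
    · simp [gammaOcto'_eq]
    · rw [Octo.vect_smul, Pi.smul_apply]
      fin_cases k <;> fin_cases l <;> simp [gammaOcto'_eq]
  rw [e1, gammaOcto_eq, map_smul] at h1
  rw [e2, gammaOcto'_eq, map_smul] at h2
  rw [vectBlock_apply]
  set y := block α.1.1 i (Octo.mk 0 (Pi.single k z))
  have s1 := congrArg Octo.scal h1
  have s2 := congrArg Octo.scal h2
  have v1 := fun l => congrFun (congrArg Octo.vect h1) l
  have v2 := fun l => congrFun (congrArg Octo.vect h2) l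
  simp only [Octo.scal_smul, Octo.scal_mk, Octo.vect_smul, Octo.vect_mk, Pi.smul_apply,
    Complex.real_smul] at s1 s2 v1 v2
  have a0 := v1 0
  have a1 := v1 1
  have a2 := v1 2
  have b0 := v2 0
  have b1 := v2 1
  have b2 := v2 2
  refine Octo.ext ?_ fun l => ?_
  · rw [Octo.scal_mk]
    fin_cases k <;> simp at s1 s2 <;> grind
  · rw [Octo.vect_mk]
    fin_cases k <;> fin_cases l <;> simp at a0 a1 a2 b0 b1 b2 ⊢ <;> grind

theorem block_eq (hα : α ∈ fixedSubgroup) (i : Fin 3) (x : Octo) :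
    block α.1.1 i x =
      Octo.mk (scalBlock α.1.1 i x.scal) fun k => vectBlock α.1.1 i k (x.vect k) := by
  have h : x = Octo.mk x.scal 0 + ∑ k, Octo.mk 0 (Pi.single k (x.vect k)) := by
    rw [Fin.sum_univ_three]
    ext k
    · simp
    · fin_cases k <;> simp
  conv_lhs => rw [h]
  rw [map_add, map_sum, Fin.sum_univ_three, block_mk_zero hα]
  simp only [block_mk_single hα]
  ext k
  · simp
  · fin_cases k <;> simp

theorem norm_scalBlock (hα : α ∈ fixedSubgroup) (i : Fin 3) (a : ℂ) :
    ‖scalBlock α.1.1 i a‖ = ‖a‖ := by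
  have h := block_re_mul_star hα i (Octo.mk a 0) (Octo.mk a 0)
  rw [block_mk_zero hα] at h
  simp [Octo.re, ← Complex.normSq_apply] at h
  rw [Complex.norm_def, h, ← Complex.norm_def]

theorem norm_vectBlock (hα : α ∈ fixedSubgroup) (i k : Fin 3) (z : ℂ) :
    ‖vectBlock α.1.1 i k z‖ = ‖z‖ := by
  have h := block_re_mul_star hα i (Octo.mk 0 (Pi.single k z)) (Octo.mk 0 (Pi.single k z))
  rw [block_mk_single hα] at h
  simp [Octo.re, ← Complex.normSq_apply] at h
  rw [Complex.norm_def, h, ← Complex.norm_def]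

theorem triality_two (hα : α ∈ fixedSubgroup) (x y : Octo) :
    block α.1.1 2 (star (x * y)) = star (block α.1.1 0 x * block α.1.1 1 y) :=
  block_triality hα 2 x y

theorem scalBlock_mul (hα : α ∈ fixedSubgroup) (a b : ℂ) :
    scalBlock α.1.1 2 (star (a * b)) = star (scalBlock α.1.1 0 a * scalBlock α.1.1 1 b) := by
  have h := triality_two hα (Octo.mk a 0) (Octo.mk b 0)
  rw [block_mk_zero hα, block_mk_zero hα, block_eq hα] at h
  simpa using congrArg Octo.scal h

theorem vectBlock_mul (hα : α ∈ fixedSubgroup) (k : Fin 3) (a n : ℂ) :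
    vectBlock α.1.1 2 k (a * n) = scalBlock α.1.1 0 a * vectBlock α.1.1 1 k n := by
  have h := triality_two hα (Octo.mk a 0) (Octo.mk 0 (Pi.single k n))
  rw [block_mk_zero hα, block_mk_single hα, block_eq hα] at h
  simpa using congrFun (congrArg Octo.vect h) k

theorem vectBlock_star_mul (hα : α ∈ fixedSubgroup) (k : Fin 3) (m b : ℂ) :
    vectBlock α.1.1 2 k (star b * m) = star (scalBlock α.1.1 1 b) * vectBlock α.1.1 0 k m := by
  have h := triality_two hα (Octo.mk 0 (Pi.single k m)) (Octo.mk b 0)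
  rw [block_mk_zero hα, block_mk_single hα, block_eq hα] at h
  simpa using congrFun (congrArg Octo.vect h) k

theorem vectBlock_cross (hα : α ∈ fixedSubgroup) (m n : ℂ) :
    vectBlock α.1.1 2 2 (star (m * n)) =
      star (vectBlock α.1.1 0 0 m * vectBlock α.1.1 1 1 n) := by
  have h := triality_two hα (Octo.mk 0 (Pi.single 0 m)) (Octo.mk 0 (Pi.single 1 n))
  rw [block_mk_single hα, block_mk_single hα, block_eq hα] at h
  simpa [crossProduct] using congrFun (congrArg Octo.vect h) 2

theorem scalBlock_zero_mul (hα : α ∈ fixedSubgroup) (a b : ℂ) :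
    scalBlock α.1.1 0 (a * b) * scalBlock α.1.1 1 1 =
      scalBlock α.1.1 0 a * scalBlock α.1.1 1 b := by
  apply star_injective
  rw [← scalBlock_mul hα, ← scalBlock_mul hα, mul_one]

/-- An element of the fixed subgroup is linear or antilinear on the `ℂ`-component of `x₁`: up to a
factor this block is a ring homomorphism, by triality. -/
theorem scalBlock_zero_eq_or (hα : α ∈ fixedSubgroup) :
    (∀ a, scalBlock α.1.1 0 a = scalBlock α.1.1 0 1 * a) ∨
      ∀ a, scalBlock α.1.1 0 a = scalBlock α.1.1 0 1 * star a := by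
  set p := scalBlock α.1.1 0 1 with hp
  set q := scalBlock α.1.1 1 1 with hq
  have hp0 : p ≠ 0 := norm_ne_zero_iff.1 (by rw [hp, norm_scalBlock hα]; simp)
  have hq0 : q ≠ 0 := norm_ne_zero_iff.1 (by rw [hq, norm_scalBlock hα]; simp)
  have hm := scalBlock_zero_mul hα
  have h1 : ∀ b, p * scalBlock α.1.1 1 b = scalBlock α.1.1 0 b * q := fun b => by
    rw [hp, ← hm, one_mul]
  -- `θ` is the block divided by its value at `1`.
  let θ : ℂ →ₗ[ℝ] ℂ := (LinearMap.mulLeft ℝ p⁻¹).comp (scalBlock α.1.1 0)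
  have hθ : ∀ a, scalBlock α.1.1 0 a = p * θ a := fun a => by
    simp [θ, hp0]
  have hmul : ∀ a b, θ (a * b) = θ a * θ b := by
    intro a b
    have e1 := hm a b
    have e2 := h1 b
    rw [hθ] at e1 e2
    rw [hθ a] at e1
    have : p * q * (θ (a * b) - θ a * θ b) = 0 := by linear_combination e1 + θ a * e2
    exact sub_eq_zero.1 ((mul_eq_zero.1 this).resolve_left (mul_ne_zero hp0 hq0))
  have hone : θ 1 = 1 := by
    simp [θ, ← hp, hp0]
  rcases Complex.real_algHom_eq_id_or_conj (AlgHom.ofLinearMap θ hone hmul) with h | h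
  · refine Or.inl fun a => ?_
    rw [hθ]
    exact congrArg (p * ·) (DFunLike.congr_fun h a)
  · refine Or.inr fun a => ?_
    rw [hθ]
    exact congrArg (p * ·) (DFunLike.congr_fun h a)

/-- If the first block is complex linear, triality expresses all twelve blocks through the values at
`1` of four of them. -/
theorem mem_range_torusHom_of_linear (hα : α ∈ fixedSubgroup)
    (h : ∀ a, scalBlock α.1.1 0 a = scalBlock α.1.1 0 1 * a) : α ∈ torusHom.range := by
  have hunit : ∀ {z : ℂ}, ‖z‖ = ‖(1 : ℂ)‖ → ∃ u : Circle, (u : ℂ) = z := fun {z} hz =>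
    ⟨⟨z, by simpa [Submonoid.unitSphere] using hz⟩, rfl⟩
  obtain ⟨p, hp⟩ := hunit (norm_scalBlock hα 0 1)
  obtain ⟨q, hq⟩ := hunit (norm_scalBlock hα 1 1)
  obtain ⟨a₀, ha₀⟩ := hunit (norm_vectBlock hα 0 0 1)
  obtain ⟨a₁, ha₁⟩ := hunit (norm_vectBlock hα 0 1 1)
  rw [← hp] at h
  have hn : ∀ z : Circle, (z : ℂ) * (starRingEnd ℂ) z = 1 := fun z => by
    rw [Complex.mul_conj, Circle.normSq_coe, Complex.ofReal_one]
  have hpn := hn p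
  have hqn := hn q
  have hs1 : ∀ b, scalBlock α.1.1 1 b = q * b := by
    intro b
    have e := scalBlock_zero_mul hα 1 b
    rw [h, h 1, ← hq] at e
    linear_combination -(starRingEnd ℂ) p * e + (b * q - scalBlock α.1.1 1 b) * hpn
  have hs2 : ∀ a, scalBlock α.1.1 2 a = (starRingEnd ℂ) (p * q) * a := by
    intro a
    have e := scalBlock_mul hα (star a) 1
    rw [mul_one, star_star, h, hs1] at e
    rw [e]
    simp
    ring
  have hv2 : ∀ k n, vectBlock α.1.1 2 k n = p * vectBlock α.1.1 1 k n := by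
    intro k n
    have e := vectBlock_mul hα k 1 n
    rwa [one_mul, h, mul_one] at e
  have hv0 : ∀ k m, vectBlock α.1.1 2 k m = (starRingEnd ℂ) q * vectBlock α.1.1 0 k m := by
    intro k m
    have e := vectBlock_star_mul hα k m 1
    rwa [star_one, one_mul, hs1, mul_one] at e
  have hl1 : ∀ k n, vectBlock α.1.1 1 k n = n * vectBlock α.1.1 1 k 1 := by
    intro k n
    have e := vectBlock_mul hα k n 1
    rw [mul_one, hv2, h] at e
    linear_combination (starRingEnd ℂ) p * e
      - (vectBlock α.1.1 1 k n - n * vectBlock α.1.1 1 k 1) * hpn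
  have hw0 : ∀ k n, vectBlock α.1.1 0 k n = q * p * vectBlock α.1.1 1 k n := by
    intro k n
    have e := hv0 k n
    rw [hv2] at e
    linear_combination -q * e - vectBlock α.1.1 0 k n * hqn
  have hl0 : ∀ k n, vectBlock α.1.1 0 k n = vectBlock α.1.1 0 k 1 * n := by
    intro k n
    rw [hw0, hw0 k 1, hl1]
    ring
  have hl2 : ∀ k n, vectBlock α.1.1 2 k n = (starRingEnd ℂ) q * (vectBlock α.1.1 0 k 1 * n) :=
    fun k n => by rw [hv0, hl0]
  have hl1' : ∀ k n, vectBlock α.1.1 1 k n =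
      (starRingEnd ℂ) (p * q) * (vectBlock α.1.1 0 k 1 * n) := by
    intro k n
    rw [← hl0, hw0, map_mul]
    linear_combination -vectBlock α.1.1 1 k n * (hpn + p * (starRingEnd ℂ) p * hqn)
  -- The vector product of the first two axes gives the relation `a₀ a₁ a₂ = p q²`.
  have ha₂ : vectBlock α.1.1 0 2 1 =
      p * q ^ 2 * (starRingEnd ℂ) ((a₀ : ℂ) * a₁) := by
    have e := vectBlock_cross hα 1 1
    rw [mul_one, star_one, hl2, hl1', ← ha₀, ← ha₁] at e
    simp only [mul_one, RCLike.star_def, map_mul, RingHomCompTriple.comp_apply,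
      RingHom.id_apply] at e ⊢
    linear_combination q * e - vectBlock α.1.1 0 2 1 * hqn
  refine ⟨![p, q, a₀, a₁], F4_ext fun X => ?_⟩
  rw [apply_eq_blocks hα, torusHom_val]
  refine Jord.ext (fun i => rfl) fun i => ?_
  rw [Jord.off_mk, block_eq hα]
  refine Octo.ext ?_ fun k => ?_
  · rw [diagonalMap_scal, torusCoeff_scal]
    fin_cases i <;> simp [-Circle.coe_inv, Circle.coe_inv_eq_conj, h (X.off 0).scal, hs1, hs2,
      mul_comm]
  · have hi : vectBlock α.1.1 i k ((X.off i).vect k) = ![1, (starRingEnd ℂ) (p * q),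
        (starRingEnd ℂ) q] i * (vectBlock α.1.1 0 k 1 * (X.off i).vect k) := by
      fin_cases i
      · exact (hl0 k _).trans (one_mul _).symm
      · exact hl1' k _
      · exact hl2 k _
    have hk : vectBlock α.1.1 0 k 1 = (![a₀, a₁, p * q ^ 2 * (a₀ * a₁)⁻¹] k : Circle) := by
      fin_cases k
      · exact ha₀.symm
      · exact ha₁.symm
      · refine ha₂.trans ?_
        rw [← Circle.coe_mul a₀, ← Circle.coe_inv_eq_conj, ← Circle.coe_pow, ← Circle.coe_mul,
          ← Circle.coe_mul]
        rfl
    have hu : (![1, (starRingEnd ℂ) (p * q), (starRingEnd ℂ) q] i : ℂ) =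
        (![1, (p * q)⁻¹, q⁻¹] i : Circle) := by
      fin_cases i <;> simp [-Circle.coe_inv, Circle.coe_inv_eq_conj, mul_comm]
    rw [diagonalMap_vect, torusCoeff_vect, Octo.vect_mk, hi, hk, hu, Circle.coe_mul, mul_assoc]
    rfl

theorem scalBlock_γ₁_mul (i : Fin 3) (a : ℂ) :
    scalBlock (γ₁ * α).1.1 i a = star (scalBlock α.1.1 i a) := rfl

/-- The fixed subgroup consists of the torus and its coset by `γ₁`. -/
theorem mem_range_torusHom_or (hα : α ∈ fixedSubgroup) :
    α ∈ torusHom.range ∨ γ₁ * α ∈ torusHom.range := by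
  rcases scalBlock_zero_eq_or hα with h | h
  · exact Or.inl (mem_range_torusHom_of_linear hα h)
  · refine Or.inr (mem_range_torusHom_of_linear (mul_mem γ₁_mem_fixedSubgroup hα) fun a => ?_)
    rw [scalBlock_γ₁_mul, scalBlock_γ₁_mul, h, star_mul', star_star]

/-! ### The semidirect product structure -/

/-- The torus as a subgroup of the fixed subgroup. -/
def torusToFixed : (Fin 4 → Circle) →* fixedSubgroup :=
  torusHom.codRestrict fixedSubgroup torusHom_mem_fixedSubgroup

/-- The involution `γ₁`, as an element of the fixed subgroup. -/
def γ₁Fixed : fixedSubgroup := ⟨γ₁, γ₁_mem_fixedSubgroup⟩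

theorem γ₁Fixed_mul_self : γ₁Fixed * γ₁Fixed = 1 := Subtype.ext γ₁_mul_γ₁

theorem γ₁Fixed_mul_torus (z : Fin 4 → Circle) :
    γ₁Fixed * torusToFixed z = torusToFixed z⁻¹ * γ₁Fixed :=
  Subtype.ext (γ₁_mul_torusHom z)

theorem Z2_cases : ∀ ε : Z2, ε = 1 ∨ ε = Multiplicative.ofAdd 1 := by decide

theorem Z2_one_ne : Multiplicative.ofAdd (1 : ZMod 2) ≠ 1 := by decide

/-- The homomorphism from `ℤ₂` that maps the generator to `γ₁`. -/
def z2ToFixed : Z2 →* fixedSubgroup where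
  toFun ε := if ε = 1 then 1 else γ₁Fixed
  map_one' := if_pos rfl
  map_mul' a b := by
    have h : Multiplicative.ofAdd (1 : ZMod 2) * Multiplicative.ofAdd 1 = 1 := by decide
    rcases Z2_cases a with rfl | rfl <;> rcases Z2_cases b with rfl | rfl <;>
      simp [h, γ₁Fixed_mul_self]

theorem z2ToFixed_generator : z2ToFixed (Multiplicative.ofAdd 1) = γ₁Fixed :=
  if_neg (t := 1) Z2_one_ne

theorem conjAction_generator (z : Fin 4 → Circle) :
    conjAction (Multiplicative.ofAdd 1) z = z⁻¹ := by
  have : conjAction (Multiplicative.ofAdd 1) = MulEquiv.inv (Fin 4 → Circle) :=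
    if_neg (t := 1) Z2_one_ne
  rw [this]
  rfl

/-- The homomorphism `(z, ε) ↦ z γ₁^ε` from the semidirect product to the fixed subgroup. -/
def semidirectHom : TorusZ2 →* fixedSubgroup :=
  SemidirectProduct.lift torusToFixed z2ToFixed fun ε => by
    refine MonoidHom.ext fun z => ?_
    rcases Z2_cases ε with rfl | rfl
    · simp
    · simp only [MonoidHom.comp_apply, MulEquiv.coe_toMonoidHom, conjAction_generator,
        z2ToFixed_generator, MulAut.conj_apply]
      rw [γ₁Fixed_mul_torus, mul_inv_cancel_right]

theorem semidirectHom_apply (x : TorusZ2) :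
    semidirectHom x = torusToFixed x.left * z2ToFixed x.right := rfl

theorem semidirectHom_injective : Function.Injective semidirectHom := by
  refine (injective_iff_map_eq_one _).2 fun x hx => ?_
  rw [semidirectHom_apply] at hx
  rcases Z2_cases x.right with h | h
  · rw [h, map_one, mul_one] at hx
    have : x.left = 1 := torusHom_injective ((congrArg Subtype.val hx).trans (map_one _).symm)
    exact SemidirectProduct.ext this h
  · rw [h, z2ToFixed_generator, mul_eq_one_iff_eq_inv, inv_eq_of_mul_eq_one_right γ₁Fixed_mul_self]
      at hx
    exact absurd (congrArg Subtype.val hx) (torusHom_ne_γ₁ x.left)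

theorem semidirectHom_surjective : Function.Surjective semidirectHom := by
  rintro ⟨α, hα⟩
  rcases mem_range_torusHom_or hα with ⟨z, hz⟩ | ⟨z, hz⟩
  · refine ⟨SemidirectProduct.inl z, Subtype.ext ?_⟩
    rw [semidirectHom_apply, SemidirectProduct.left_inl, SemidirectProduct.right_inl, map_one,
      mul_one]
    exact hz
  · refine ⟨⟨z⁻¹, Multiplicative.ofAdd 1⟩, Subtype.ext ?_⟩
    rw [semidirectHom_apply, z2ToFixed_generator]
    change torusHom z⁻¹ * γ₁ = α
    rw [← γ₁_mul_torusHom, hz, ← mul_assoc, γ₁_mul_γ₁, one_mul]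

instance : CompactSpace TorusZ2 := by
  have h : Topology.IsInducing (SemidirectProduct.equivProd (φ := conjAction)) := ⟨rfl⟩
  have hc : IsClosed (Set.range (SemidirectProduct.equivProd (φ := conjAction))) := by
    rw [Equiv.range_eq_univ]
    exact isClosed_univ
  refine ⟨h.isCompact_iff.2 ?_⟩
  rw [Set.image_univ]
  exact hc.isCompact

theorem continuous_left : Continuous (SemidirectProduct.left : TorusZ2 → Fin 4 → Circle) :=
  continuous_fst.comp
    (continuous_induced_dom (f := SemidirectProduct.equivProd (φ := conjAction)))

theorem continuous_right : Continuous (SemidirectProduct.right : TorusZ2 → Z2) :=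
  continuous_snd.comp
    (continuous_induced_dom (f := SemidirectProduct.equivProd (φ := conjAction)))

theorem continuous_torusToFixed : Continuous torusToFixed :=
  continuous_torusHom.subtype_mk _

theorem continuous_semidirectHom : Continuous semidirectHom :=
  (continuous_torusToFixed.comp continuous_left).mul
    ((continuous_of_discreteTopology (f := z2ToFixed)).comp continuous_right)

/-- A continuous bijective homomorphism from a compact group to a Hausdorff group, as an
isomorphism of topological groups. -/
def continuousMulEquivOfCompact {G H : Type*} [Group G] [TopologicalSpace G] [CompactSpace G]
    [Group H] [TopologicalSpace H] [T2Space H] (f : G →* H) (hf : Continuous f)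
    (hb : Function.Bijective f) : G ≃ₜ* H :=
  { MulEquiv.ofBijective f hb with
    continuous_toFun := hf
    continuous_invFun :=
      (Continuous.homeoOfEquivCompactToT2 (f := (MulEquiv.ofBijective f hb).toEquiv)
        hf).symm.continuous }

/-- The isomorphism of the semidirect product with the fixed subgroup. -/
def semidirectEquiv : TorusZ2 ≃ₜ* fixedSubgroup :=
  continuousMulEquivOfCompact semidirectHom continuous_semidirectHom
    ⟨semidirectHom_injective, semidirectHom_surjective⟩

theorem semidirectEquiv_inr :
    semidirectEquiv (SemidirectProduct.inr (Multiplicative.ofAdd 1)) = γ₁Fixed := by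
  change semidirectHom _ = _
  rw [semidirectHom_apply, SemidirectProduct.left_inr, SemidirectProduct.right_inr, map_one,
    one_mul, z2ToFixed_generator]

/-! ### The identity component and maximality -/

/-- The torus is the preimage of a point under a continuous map to a discrete space. -/
theorem range_torusToFixed :
    Set.range torusToFixed = (fun x => (semidirectEquiv.symm x).right) ⁻¹' {1} := by
  ext x
  obtain ⟨y, rfl⟩ := semidirectEquiv.surjective x
  simp only [Set.mem_range, Set.mem_preimage, ContinuousMulEquiv.symm_apply_apply,
    Set.mem_singleton_iff]
  constructor
  · rintro ⟨z, hz⟩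
    have : semidirectHom (SemidirectProduct.inl z) = semidirectHom y := by
      rw [semidirectHom_apply, SemidirectProduct.left_inl, SemidirectProduct.right_inl, map_one,
        mul_one]
      exact hz
    rw [← semidirectHom_injective this, SemidirectProduct.right_inl]
  · intro h
    refine ⟨y.left, ?_⟩
    change _ = semidirectHom y
    rw [semidirectHom_apply, h, map_one, mul_one]

theorem connectedComponent_fixedSubgroup :
    connectedComponent (1 : fixedSubgroup) = Set.range torusToFixed := by
  refine Set.Subset.antisymm ?_ ?_
  · refine IsClopen.connectedComponent_subset ?_ ⟨1, map_one _⟩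
    rw [range_torusToFixed]
    exact (isClopen_discrete {1}).preimage
      (continuous_right.comp semidirectEquiv.symm.continuous_toFun)
  · exact (isPreconnected_range continuous_torusToFixed).subset_connectedComponent
      ⟨1, map_one _⟩

theorem identityComponent_fixedSubgroup :
    identityComponent fixedSubgroup = torusHom.range := by
  have h : Subgroup.connectedComponentOfOne fixedSubgroup = torusToFixed.range :=
    SetLike.coe_injective connectedComponent_fixedSubgroup
  rw [identityComponent, h, MonoidHom.map_range]
  rfl

/-- The isomorphism of the diagonal torus with `U(1)^{×4}`. -/
def torusRangeEquiv : torusHom.range ≃ₜ* (Fin 4 → Circle) :=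
  (continuousMulEquivOfCompact torusHom.rangeRestrict (continuous_torusHom.subtype_mk _)
    ⟨MonoidHom.rangeRestrict_injective_iff.2 torusHom_injective,
      torusHom.rangeRestrict_surjective⟩).symm

/-- A torus that contains the diagonal torus commutes with `γ`, `γ'`, `σ`, `σ'`, hence lies in the
fixed subgroup, and by connectedness in its identity component. -/
theorem isMaximalTorus_range_torusHom : IsMaximalTorus torusHom.range := by
  refine ⟨⟨4, ⟨torusRangeEquiv⟩⟩, fun T ⟨n, ⟨e⟩⟩ hT => ?_⟩
  have hK : T ≤ fixedSubgroup := by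
    intro α hα
    refine Subgroup.mem_centralizer_iff.2 fun τ hτ => ?_
    obtain ⟨z, -, -, rfl⟩ := mem_range_torusHom hτ
    have : (⟨_, hT ⟨z, rfl⟩⟩ : T) * ⟨α, hα⟩ = ⟨α, hα⟩ * ⟨_, hT ⟨z, rfl⟩⟩ :=
      e.injective (by rw [map_mul, map_mul, mul_comm])
    exact congrArg Subtype.val this
  have hc : IsPreconnected (Set.range (Subgroup.inclusion hK)) := by
    have : Set.range (Subgroup.inclusion hK) = Set.range (Subgroup.inclusion hK ∘ e.symm) :=
      (e.symm.surjective.range_comp _).symm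
    rw [this]
    exact isPreconnected_range
      ((continuous_subtype_val.subtype_mk _).comp e.symm.continuous_toFun)
  have h1 := hc.subset_connectedComponent (x := 1) ⟨1, map_one _⟩
  rw [connectedComponent_fixedSubgroup] at h1
  intro α hα
  obtain ⟨z, hz⟩ := h1 ⟨⟨α, hα⟩, rfl⟩
  exact ⟨z, congrArg Subtype.val hz⟩

end ExcF4
end
open ExcF4 in
theorem theorem2p3 :
    -- the involutions
    (InG2 γ ∧ InG2 γ' ∧ InG2 γ₁ ∧
      (∀ τ ∈ ({γ, γ', σ, σ', γ₁} : Set F4), orderOf τ = 2) ∧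
      (∀ τ ∈ ({γ, γ', σ, σ', γ₁} : Set F4), ∀ τ' ∈ ({γ, γ', σ, σ', γ₁} : Set F4),
        τ * τ' = τ' * τ)) ∧
    -- the identity component is a torus of dimension four, and a maximal torus of `F₄`
    Nonempty (identityComponent fixedSubgroup ≃ₜ* (Fin 4 → Circle)) ∧
    IsMaximalTorus (identityComponent fixedSubgroup) ∧
    -- the whole group is the semidirect product, with `ℤ₂ = {1, γ₁}`
    (∃ h : γ₁ ∈ fixedSubgroup, ∃ f : fixedSubgroup ≃ₜ* TorusZ2,
      f ⟨γ₁, h⟩ = SemidirectProduct.inr (Multiplicative.ofAdd 1)) := by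
  refine ⟨⟨inG2_γ, inG2_γ', inG2_γ₁, fun τ hτ => orderOf_involution hτ,
    fun τ hτ τ' hτ' => involution_comm hτ hτ'⟩, ?_, ?_, γ₁_mem_fixedSubgroup,
    semidirectEquiv.symm, ?_⟩
  · rw [identityComponent_fixedSubgroup]
    exact ⟨torusRangeEquiv⟩
  · rw [identityComponent_fixedSubgroup]
    exact isMaximalTorus_range_torusHom
  · change semidirectEquiv.symm γ₁Fixed = _
    rw [← semidirectEquiv_inr, ContinuousMulEquiv.symm_apply_apply]
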